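/- Let $n\ge 1$ and $0<\lambda\le 1\le\Lambda$. Points of $\mathbb R^n\times\mathbb R$ are written $(x,t)$, $B_1$ is the open unit ball of $\mathbb R^n$, $Q_1=B_1\times(-1,0]$, $\overline Q_1=\overline B_1\times[-1,0]$, $|E|$ is $(n+1)$-dimensional Lebesgue (outer) measure, and $\mathrm{Sym}(n)$ is the space of real symmetric $n\times n$ matrices with the spectral norm. Put $$PB_T^{-\theta}(x_0,t_0)=\{(x,t):\ \theta|x-x_0|^2\le t_0-t\le T\},\qquad \eta_2=4^{-(1+n/2)}(\sqrt2+1)^{-n},\qquad c_0=\frac{\lambda^2}{\Lambda^2(n+5)}\,e^{-10^3\Lambda n/\lambda}.$$ A function $\varphi$ contacts $v$ from below (resp. above) at $(x,t)$ if $\varphi(x,t)=v(x,t)$ and $\varphi<v$ (resp. $\varphi>v$) at all $(\xi,\tau)$ with $\xi\in B_1$, $\tau<t$. For a bounded $u\in C(\overline B_1\times\mathbb R)$ and $a>0$, let $A_a$ be the set of $(x,t)\in\overline B_1\times\mathbb R$ at which, for some $(y,s)\in\overline Q_1$, the parabola $-\frac a2|\xi-y|^2+a(\tau-s)$ contacts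 $u-\inf_{Q_1}u$ from below. The function $u$ is locally uniformly semi-concave if for every compact $Z\subset Q_1$ there is $b>0$ such that at each $(x,t)\in Z$ some parabola $\frac b2|\xi-y|^2-b(\tau-s)$, $(y,s)\in\mathbb R^n\times\mathbb R$, contacts $u$ from above. Let $\delta>0$. We say that $F:\mathrm{Sym}(n)\to\mathbb R$ satisfies (H) if $F(0)=0$ and, for all $M$ with $\|M\|<\delta$ and all $N\ge0$: $F(M+N)\ge F(M)$, and moreover $\lambda\|N\|\le F(M+N)-F(M)\le\Lambda\|N\|$ if $\|N\|\le\delta$. The inequality $F(D^2u)-u_t\le0$ in $Q_1$ is understood in the viscosity sense: $F(D^2\varphi(x,t))-\varphi_t(x,t)\le0$ whenever $(x,t)\in Q_1$ and $\varphi$ is a smooth function with $\varphi(x,t)=u(x,t)$ and $\varphi\le u$ at all points $(\xi,\tau)$ near $(x,t)$ with $\tau\le t$. **Proposition.** There is a constant $c_1\in(0,1)$ depending only on $n,\lambda,\Lambda$ such that the following holds. Let $\delta>0$, let $F$ satisfy (H), let $u\in C(\overline B_1\times\mathbb R)$ be bounded and locally uniformly semi-concave with $F(D^2u)-u_t\le0$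 in $Q_1$ in the viscosity sense, let $\frac34\le\theta\le4$, $T_0>0$ and $PB_{T_0}^{-\theta}(x_0,t_0)\subset Q_1$, and let $a\in(0,c_0\delta)$ be such that $(x_0,t_0)\in A_a$. Then for every integer $k\ge0$ with $c_1^{-k}a\le c_0\delta$, $$\bigl|PB_{T_0}^{-\theta}(x_0,t_0)\setminus A_{c_1^{-k}a}\bigr|\le(1-\eta_2c_1)^k\,\bigl|PB_{T_0}^{-\theta}(x_0,t_0)\bigr|.$$ -/

import Mathlib

open Set Filter Topology MeasureTheory
open scoped ContDiff

namespace ParabolicContact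

noncomputable section

/-- The space `ℝⁿ` with its Euclidean norm. Space-time `ℝⁿ × ℝ` carries the product topology and
the product Lebesgue measure (`volume`), i.e. `(n+1)`-dimensional Lebesgue measure. -/
abbrev Space (n : ℕ) : Type := EuclideanSpace ℝ (Fin n)

/-- Real symmetric `n × n` matrices (over `ℝ`, the star operation on matrices is the transpose). -/
abbrev SymMat (n : ℕ) : Type := selfAdjoint (Matrix (Fin n) (Fin n) ℝ)

/-- The spectral norm of a symmetric matrix: its operator norm on Euclidean `ℝⁿ`. -/
def specNorm {n : ℕ} (M : SymMat n) : ℝ :=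
  ‖Matrix.toEuclideanCLM (𝕜 := ℝ) (n := Fin n) (M : Matrix (Fin n) (Fin n) ℝ)‖

/-- `N ≥ 0` for a symmetric matrix. -/
def Nonneg {n : ℕ} (N : SymMat n) : Prop := (N : Matrix (Fin n) (Fin n) ℝ).PosSemidef

/-- The structure conditions on an operator `F : Sym(n) → ℝ` in the `δ`-neighbourhood of `0`:
ellipticity, uniform ellipticity with constants `lam ≤ Lam`, and the fact that the zero function
solves `F(D²φ) - φ_t = 0`. Nothing is asked about `F` away from matrices of norm less than `δ`,
beyond the one-sided comparison `F (M + N) ≥ F M`. -/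
structure StructureConditions {n : ℕ} (lam Lam δ : ℝ) (F : SymMat n → ℝ) : Prop where
  elliptic : ∀ M : SymMat n, specNorm M < δ → ∀ N : SymMat n, Nonneg N → F M ≤ F (M + N)
  uniformly_elliptic : ∀ M : SymMat n, specNorm M < δ → ∀ N : SymMat n, Nonneg N → specNorm N ≤ δ →
    lam * specNorm N ≤ F (M + N) - F M ∧ F (M + N) - F M ≤ Lam * specNorm N
  zero_solution : F 0 = 0

/-- The parabolic cylinder `Q₁ = B₁ × (-1, 0]`. -/
def Q₁ (n : ℕ) : Set (Space n × ℝ) := Metric.ball 0 1 ×ˢ Ioc (-1) 0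

/-- The closed cylinder `B̄₁ × [-1, 0]`. -/
def closedQ₁ (n : ℕ) : Set (Space n × ℝ) := Metric.closedBall 0 1 ×ˢ Icc (-1) 0

/-- The (downward) parabolic ball `PB_T^{-θ}(x, t)`. -/
def lowerPB {n : ℕ} (θ T : ℝ) (x : Space n) (t : ℝ) : Set (Space n × ℝ) :=
  {z | θ * ‖z.1 - x‖ ^ 2 ≤ t - z.2 ∧ t - z.2 ≤ T}

/-- The concave parabola of opening `a` and vertex `(y, s)`. -/
def concaveParabola {n : ℕ} (a : ℝ) (y : Space n) (s : ℝ) (z : Space n × ℝ) : ℝ :=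
  -(a / 2) * ‖z.1 - y‖ ^ 2 + a * (z.2 - s)

/-- The convex parabola of opening `b` and vertex `(y, s)`. -/
def convexParabola {n : ℕ} (b : ℝ) (y : Space n) (s : ℝ) (z : Space n × ℝ) : ℝ :=
  b / 2 * ‖z.1 - y‖ ^ 2 - b * (z.2 - s)

/-- `φ` contacts `u` at `(x, t)` from below; only times `τ < t` are compared. -/
def ContactsBelow {n : ℕ} (φ u : Space n × ℝ → ℝ) (x : Space n) (t : ℝ) : Prop :=
  (∀ ξ ∈ Metric.ball (0 : Space n) 1, ∀ τ < t, φ (ξ, τ) < u (ξ, τ)) ∧ φ (x, t) = u (x, t)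

/-- `φ` contacts `u` at `(x, t)` from above; only times `τ < t` are compared. -/
def ContactsAbove {n : ℕ} (φ u : Space n × ℝ → ℝ) (x : Space n) (t : ℝ) : Prop :=
  (∀ ξ ∈ Metric.ball (0 : Space n) 1, ∀ τ < t, u (ξ, τ) < φ (ξ, τ)) ∧ φ (x, t) = u (x, t)

/-- The contact set `A_a(E, u)`. The minimum of `u` over `Q₁` is written as an infimum
(`u` is bounded in all uses). -/
def contactSet {n : ℕ} (a : ℝ) (E : Set (Space n × ℝ)) (u : Space n × ℝ → ℝ) :
    Set (Space n × ℝ) :=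
  {z | z.1 ∈ Metric.closedBall (0 : Space n) 1 ∧ ∃ y s, (y, s) ∈ E ∧
    ContactsBelow (concaveParabola a y s) (fun w => u w - sInf (u '' Q₁ n)) z.1 z.2}

/-- Local uniform semi-concavity in `Q₁`. -/
def LocallyUniformlySemiconcave {n : ℕ} (u : Space n × ℝ → ℝ) : Prop :=
  ∀ Z : Set (Space n × ℝ), IsCompact Z → Z ⊆ Q₁ n → ∃ b : ℝ, 0 < b ∧
    ∀ z ∈ Z, ∃ y s, ContactsAbove (convexParabola b y s) u z.1 z.2

/-- The `(i, j)` entry of the Hessian of `φ` in the space variables at `(x, t)`. -/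
def spatialHessian {n : ℕ} (φ : Space n × ℝ → ℝ) (x : Space n) (t : ℝ) (i j : Fin n) : ℝ :=
  iteratedFDeriv ℝ 2 (fun ξ : Space n => φ (ξ, t)) x
    ![EuclideanSpace.single i 1, EuclideanSpace.single j 1]

/-- `F(D²u) - u_t ≤ 0` in `Q₁` in the viscosity sense: whenever a smooth `φ` touches `u` from below
at a point `(x, t)` of `Q₁`, locally and for times `τ ≤ t`, one has
`F(D²φ(x, t)) - φ_t(x, t) ≤ 0`. -/
def IsViscositySupersolution {n : ℕ} (F : SymMat n → ℝ) (u : Space n × ℝ → ℝ) : Prop :=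
  ∀ (x : Space n) (t : ℝ), (x, t) ∈ Q₁ n → ∀ φ : Space n × ℝ → ℝ, ContDiff ℝ ∞ φ →
    φ (x, t) = u (x, t) → (∀ᶠ z in 𝓝 (x, t), z.2 ≤ t → φ z ≤ u z) →
    ∀ M : SymMat n, (∀ i j, (M : Matrix (Fin n) (Fin n) ℝ) i j = spatialHessian φ x t i j) →
      F M - deriv (fun τ : ℝ => φ (x, τ)) t ≤ 0

/-- The constant `c₀ = λ² / (Λ² (n+5)) · exp(-10³ Λ n / λ)`. -/
def c₀ (n : ℕ) (lam Lam : ℝ) : ℝ :=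
  lam ^ 2 / (Lam ^ 2 * ((n : ℝ) + 5)) * Real.exp (-(10 ^ 3 * Lam * n / lam))

/-- The dimensional constant `η₂ = 4^{-(1+n/2)} (√2+1)^{-n}`. -/
def η₂ (n : ℕ) : ℝ := (4 : ℝ) ^ (-(1 + (n : ℝ) / 2)) * (√2 + 1) ^ (-(n : ℝ))

end

end ParabolicContact

open ParabolicContact

/-! Write `v = u - inf u` and let `P` be the parabolic ball. The heart is a single decay step: if
`(x₀, t₀)` lies in the contact set `A` of opening `a`, the contact set `A'` of opening
`openingFactor lam Lam * a` captures a fixed fraction of `P \ A`. Contact is taken non-strict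
(`closedContactSet`), which makes `P ∩ A` compact; strictness is recovered at the end by enlarging
the opening.

For `z ∈ P \ A` the upward paraboloid from `z` contains `(x₀, t₀)`, so it meets `A` at a first
height `θ r²`. Below that height there is room for a cylinder of size `r` inside `P \ A`. A barrier
in a moving tube that ends at the contact point shows that somewhere in this cylinder `v` exceeds
the touching parabola by at most a multiple of `a r²` (`exists_near_touching`). Adding parabolas of
larger opening, with vertices filling a small cylinder of size `r`, then forces contact inside the
middle cylinder, at points of `A'`. The vertices have measure of order `r ^ (n + 2)`; by
`volume_vertices_le` so do at least the contact points. A Vitali covering by middle cylinders sums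
this up (`volume_diff_le`).

The bound of vertices by contact points rests on `touching_gap` instead of an area formula: contact
points at parabolic distance `r` have vertices at parabolic distance `O(r)`, up to a shear. Suppose
`P₀` and `P₀ + ℓ` touch `v` at nearby points with `ℓ` affine and large. Either `v` drops too much in
too short a time (`drop_le`), or `v` touches from above, near the crease, the convex function `max
(P₀, P₀ + ℓ)` (`crease_absurd`); explicit strict subsolutions exclude both. A second Vitali
covering, now of the contact points, turns the gap estimate into the measure bound. -/

namespace ParabolicContact

open scoped RealInnerProductSpace

/-! ### Symmetric matrices and the ellipticity bound. -/

section Matrices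

variable {n : ℕ}

/-- The quadratic form of a symmetric matrix. -/
noncomputable def quadForm (M : SymMat n) (v : Space n) : ℝ :=
  ⟪v, Matrix.toEuclideanCLM (𝕜 := ℝ) (n := Fin n) (M : Matrix (Fin n) (Fin n) ℝ) v⟫

/-- The symmetric matrix `g ⊗ g`. -/
noncomputable def dyad (g : Space n) : SymMat n :=
  ⟨Matrix.vecMulVec g.ofLp g.ofLp, by
    rw [selfAdjoint.mem_iff, Matrix.star_eq_conjTranspose, Matrix.conjTranspose_vecMulVec]
    simp⟩

lemma toEuclideanCLM_dyad (g v : Space n) :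
    Matrix.toEuclideanCLM (𝕜 := ℝ) (n := Fin n) (dyad g : Matrix (Fin n) (Fin n) ℝ) v
      = ⟪g, v⟫ • g := by
  ext i
  simp [dyad, Matrix.ofLp_toEuclideanCLM, Matrix.vecMulVec_mulVec,
    EuclideanSpace.inner_eq_star_dotProduct, dotProduct_comm, mul_comm]

lemma specNorm_dyad (g : Space n) : specNorm (dyad g) = ‖g‖ ^ 2 := by
  unfold specNorm
  have : Matrix.toEuclideanCLM (𝕜 := ℝ) (n := Fin n) (dyad g : Matrix (Fin n) (Fin n) ℝ)
      = InnerProductSpace.rankOne ℝ g g := by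
    ext1 v
    rw [toEuclideanCLM_dyad, InnerProductSpace.rankOne_apply]
  rw [this, InnerProductSpace.norm_rankOne, sq]

lemma quadForm_dyad (g v : Space n) : quadForm (dyad g) v = ⟪g, v⟫ ^ 2 := by
  rw [quadForm, toEuclideanCLM_dyad, inner_smul_right, real_inner_comm v g, sq]

lemma quadForm_add (M N : SymMat n) (v : Space n) :
    quadForm (M + N) v = quadForm M v + quadForm N v := by
  simp [quadForm, inner_add_right]

lemma quadForm_sub (M N : SymMat n) (v : Space n) :
    quadForm (M - N) v = quadForm M v - quadForm N v := by
  simp [quadForm, inner_sub_right]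

lemma quadForm_smul_one (k : ℝ) (v : Space n) :
    quadForm (k • (1 : SymMat n)) v = k * ‖v‖ ^ 2 := by
  have : ((k • (1 : SymMat n) : SymMat n) : Matrix (Fin n) (Fin n) ℝ) = k • 1 := by simp
  simp [quadForm, this, inner_smul_right]

lemma nonneg_of_quadForm_nonneg {M : SymMat n} (h : ∀ v, 0 ≤ quadForm M v) : Nonneg M := by
  refine Matrix.PosSemidef.of_dotProduct_mulVec_nonneg M.2 fun x => ?_
  have := h (WithLp.toLp 2 x)
  rwa [quadForm, Matrix.inner_toEuclideanCLM] at this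

lemma specNorm_smul_one (hn : 1 ≤ n) (k : ℝ) : specNorm (k • (1 : SymMat n)) = |k| := by
  have : ((k • (1 : SymMat n) : SymMat n) : Matrix (Fin n) (Fin n) ℝ) = k • 1 := by simp
  have h1 : Nonempty (Fin n) := ⟨⟨0, hn⟩⟩
  simp [specNorm, this, norm_smul]

lemma specNorm_add_le (M N : SymMat n) : specNorm (M + N) ≤ specNorm M + specNorm N := by
  simpa [specNorm] using norm_add_le _ _

/-- The structure conditions bound `F M` from below once the quadratic form of `M` is bounded
below by `-k |v|² + ⟨g, v⟩²` with small `k` and `g`. -/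
lemma StructureConditions.lower_bound (hn : 1 ≤ n) {lam Lam δ : ℝ} {F : SymMat n → ℝ}
    (hF : StructureConditions lam Lam δ F) {k : ℝ} {g : Space n} {M : SymMat n} (hk : 0 ≤ k)
    (hkg : k + ‖g‖ ^ 2 < δ) (hM : ∀ v, -k * ‖v‖ ^ 2 + ⟪g, v⟫ ^ 2 ≤ quadForm M v) :
    lam * ‖g‖ ^ 2 - Lam * k ≤ F M := by
  have hg : 0 ≤ ‖g‖ ^ 2 := by positivity
  have h1 : specNorm ((-k) • (1 : SymMat n)) = k := by
    rw [specNorm_smul_one hn, abs_neg, abs_of_nonneg hk]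
  have h1' : specNorm (k • (1 : SymMat n)) = k := by
    rw [specNorm_smul_one hn, abs_of_nonneg hk]
  have hA := (hF.uniformly_elliptic ((-k) • (1 : SymMat n)) (by linarith) (k • (1 : SymMat n))
    (nonneg_of_quadForm_nonneg fun v => by rw [quadForm_smul_one]; positivity) (by linarith)).2
  have h0 : (-k) • (1 : SymMat n) + k • (1 : SymMat n) = 0 := by
    rw [← add_smul]; simp
  rw [h0, hF.zero_solution, h1'] at hA
  have hB := (hF.uniformly_elliptic ((-k) • (1 : SymMat n)) (by linarith) (dyad g)
    (nonneg_of_quadForm_nonneg fun v => by rw [quadForm_dyad]; positivity)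
    (by rw [specNorm_dyad]; linarith)).1
  rw [specNorm_dyad] at hB
  -- `M` may be far from the `δ`-ball. Only `-k I + g ⊗ g` has to be small, since the last
  -- comparison uses one-sided ellipticity alone.
  have hC := hF.elliptic ((-k) • (1 : SymMat n) + dyad g)
    (by have := specNorm_add_le ((-k) • (1 : SymMat n)) (dyad g)
        rw [h1, specNorm_dyad] at this; linarith)
    (M - ((-k) • (1 : SymMat n) + dyad g))
    (nonneg_of_quadForm_nonneg fun v => by
      rw [quadForm_sub, quadForm_add, quadForm_smul_one, quadForm_dyad]
      linarith [hM v])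
  rw [add_sub_cancel] at hC
  linarith

end Matrices

/-! ### Hessians read off from restrictions to lines. -/

section Hessian

variable {n : ℕ}

lemma spatialHessian_eq (φ : Space n × ℝ → ℝ) (x : Space n) (t : ℝ) (i j : Fin n) :
    spatialHessian φ x t i j = fderiv ℝ (fderiv ℝ fun ξ : Space n => φ (ξ, t)) x
      (EuclideanSpace.single i 1) (EuclideanSpace.single j 1) := by
  simp [spatialHessian, iteratedFDeriv_two_apply]

lemma spatialHessian_add_const (φ : Space n × ℝ → ℝ) (c : ℝ) (x : Space n) (t : ℝ)
    (i j : Fin n) :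
    spatialHessian (fun z => φ z + c) x t i j = spatialHessian φ x t i j := by
  simp only [spatialHessian_eq]
  have : (fderiv ℝ fun ξ : Space n => φ (ξ, t) + c) = fderiv ℝ fun ξ : Space n => φ (ξ, t) := by
    ext1 y; exact fderiv_add_const c
  rw [this]

lemma contDiff_slice {φ : Space n × ℝ → ℝ} (hφ : ContDiff ℝ ∞ φ) (t : ℝ) :
    ContDiff ℝ ∞ fun ξ : Space n => φ (ξ, t) :=
  hφ.comp (contDiff_id.prodMk contDiff_const)

lemma exists_hessian {φ : Space n × ℝ → ℝ} (hφ : ContDiff ℝ ∞ φ) (x : Space n) (t : ℝ) :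
    ∃ M : SymMat n, ∀ i j, (M : Matrix (Fin n) (Fin n) ℝ) i j = spatialHessian φ x t i j := by
  refine ⟨⟨Matrix.of fun i j => spatialHessian φ x t i j, ?_⟩, fun i j => rfl⟩
  rw [selfAdjoint.mem_iff, Matrix.star_eq_conjTranspose]
  ext i j
  simp only [Matrix.conjTranspose_apply, Matrix.of_apply, star_trivial, spatialHessian_eq]
  exact ((contDiff_slice hφ t).contDiffAt.isSymmSndFDerivAt
    (by simp only [minSmoothness_of_isRCLikeNormedField]; exact WithTop.coe_le_coe.2 (le_top : (2 : ℕ∞) ≤ ⊤))).eq _ _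

lemma quadForm_hessian {φ : Space n × ℝ → ℝ} {x : Space n} {t : ℝ} {M : SymMat n}
    (hM : ∀ i j, (M : Matrix (Fin n) (Fin n) ℝ) i j = spatialHessian φ x t i j) (v : Space n) :
    quadForm M v = fderiv ℝ (fderiv ℝ fun ξ : Space n => φ (ξ, t)) x v v := by
  have hv : v = ∑ i, v i • (EuclideanSpace.single i (1 : ℝ) : Space n) := by
    ext j
    simp [Pi.single_apply]
  rw [quadForm, Matrix.inner_toEuclideanCLM]
  conv_rhs => rw [hv]
  simp only [dotProduct, Matrix.mulVec, hM, spatialHessian_eq, map_sum, map_smul,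
    sum_apply, smul_apply, smul_eq_mul, Finset.mul_sum]
  rw [Finset.sum_comm]
  refine Finset.sum_congr rfl fun i _ => Finset.sum_congr rfl fun j _ => by ring

lemma hasDerivAt_quartic (c₀ c₁ c₂ c₃ c₄ s : ℝ) :
    HasDerivAt (fun s : ℝ => c₀ + c₁ * s + c₂ * s ^ 2 + c₃ * s ^ 3 + c₄ * s ^ 4)
      (c₁ + 2 * c₂ * s + 3 * c₃ * s ^ 2 + 4 * c₄ * s ^ 3) s := by
  have h := (((((hasDerivAt_id' s).const_mul c₁).const_add c₀).fun_add
    ((hasDerivAt_pow 2 s).const_mul c₂)).fun_add ((hasDerivAt_pow 3 s).const_mul c₃)).fun_add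
    ((hasDerivAt_pow 4 s).const_mul c₄)
  refine h.congr_deriv ?_
  norm_num
  ring

lemma hasDerivAt_line (x v : Space n) (s : ℝ) : HasDerivAt (fun s : ℝ => x + s • v) v s := by
  simpa using ((hasDerivAt_id s).smul_const v).const_add x

/-- The second derivative along a line on which the function is a quartic polynomial. -/
lemma fderiv_fderiv_of_quartic {f : Space n → ℝ} (hf : ContDiff ℝ ∞ f) {x v : Space n}
    {c₀ c₁ c₂ c₃ c₄ : ℝ}
    (h : ∀ s : ℝ, f (x + s • v) = c₀ + c₁ * s + c₂ * s ^ 2 + c₃ * s ^ 3 + c₄ * s ^ 4) :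
    fderiv ℝ (fderiv ℝ f) x v v = 2 * c₂ := by
  have hd : Differentiable ℝ f := hf.differentiable (by simp)
  have hd2 : Differentiable ℝ (fderiv ℝ f) :=
    (hf.fderiv_right (m := ∞) (by simp)).differentiable (by simp)
  have h1 : ∀ s : ℝ, fderiv ℝ f (x + s • v) v
      = c₁ + 2 * c₂ * s + 3 * c₃ * s ^ 2 + 4 * c₄ * s ^ 3 := fun s => by
    have e1 : HasDerivAt (fun s : ℝ => f (x + s • v)) (fderiv ℝ f (x + s • v) v) s :=
      (hd (x + s • v)).hasFDerivAt.comp_hasDerivAt s (hasDerivAt_line x v s)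
    rw [funext h] at e1
    exact e1.unique (hasDerivAt_quartic c₀ c₁ c₂ c₃ c₄ s)
  have e0 : HasDerivAt (fun s : ℝ => fderiv ℝ f (x + s • v))
      (fderiv ℝ (fderiv ℝ f) (x + (0 : ℝ) • v) v) 0 :=
    (hd2 (x + (0 : ℝ) • v)).hasFDerivAt.comp_hasDerivAt 0 (hasDerivAt_line x v 0)
  have e1 : HasDerivAt (fun s : ℝ => fderiv ℝ f (x + s • v) v)
      (fderiv ℝ (fderiv ℝ f) (x + (0 : ℝ) • v) v v) 0 := by
    simpa using e0.clm_apply (hasDerivAt_const (0 : ℝ) v)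
  rw [funext h1] at e1
  have e2 := hasDerivAt_quartic c₁ (2 * c₂) (3 * c₃) (4 * c₄) 0 0
  simp only [zero_mul, add_zero] at e2
  have := e1.unique e2
  simpa using this

end Hessian

/-! ### Comparison with strict subsolutions. -/

section Comparison

variable {n : ℕ} {F : SymMat n → ℝ} {u : Space n × ℝ → ℝ}

/-- A smooth function that is a strict subsolution off the part of a compact set where it lies below
a supersolution lies below the supersolution on the whole compact set. -/
lemma IsViscositySupersolution.comparison (hu : IsViscositySupersolution F u)
    {K : Set (Space n × ℝ)} (hK : IsCompact K) (hc : ContinuousOn u K) {Φ : Space n × ℝ → ℝ}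
    (hΦ : ContDiff ℝ ∞ Φ)
    (h : ∀ z ∈ K, Φ z ≤ u z ∨ (z ∈ Q₁ n ∧ (∀ᶠ w in 𝓝 z, w.2 ≤ z.2 → w ∈ K) ∧
      ∀ M : SymMat n, (∀ i j, (M : Matrix (Fin n) (Fin n) ℝ) i j = spatialHessian Φ z.1 z.2 i j) →
        deriv (fun τ : ℝ => Φ (z.1, τ)) z.2 < F M)) :
    ∀ z ∈ K, Φ z ≤ u z := by
  intro z hz
  obtain ⟨m, hm, hmin⟩ := hK.exists_isMinOn ⟨z, hz⟩ (hc.sub hΦ.continuous.continuousOn)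
  have hmin' : ∀ w ∈ K, u m - Φ m ≤ u w - Φ w := fun w hw => hmin hw
  by_contra hlt
  have hneg : u m < Φ m := by linarith [hmin' z hz]
  rcases h m hm with h1 | ⟨hQ, hK', hF⟩
  · linarith
  obtain ⟨M, hM⟩ := exists_hessian hΦ m.1 m.2
  have h2 := hu m.1 m.2 hQ (fun w => Φ w + (u m - Φ m)) (hΦ.add contDiff_const) (by simp)
    (by
      filter_upwards [hK'] with w hw hw2
      linarith [hmin' w (hw hw2)]) M (fun i j => by rw [hM, spatialHessian_add_const])
  have h3 := hF M hM
  rw [deriv_add_const] at h2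
  linarith

lemma IsViscositySupersolution.sub_const (hu : IsViscositySupersolution F u) (c : ℝ) :
    IsViscositySupersolution F fun z => u z - c := by
  intro x t hxt φ hφ h1 h2 M hM
  have := hu x t hxt (fun z => φ z + c) (hφ.add contDiff_const) (by simp [h1])
    (by filter_upwards [h2] with w hw hw2; linarith [hw hw2]) M
    (fun i j => by rw [hM, spatialHessian_add_const])
  rwa [deriv_add_const] at this

/-- A criterion for the strict subsolution inequality at a point, for functions that are quartic
along all lines. -/
lemma StructureConditions.strict_subsolution (hn : 1 ≤ n) {lam Lam δ : ℝ}
    (hF : StructureConditions lam Lam δ F) {Φ : Space n × ℝ → ℝ} (hΦ : ContDiff ℝ ∞ Φ)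
    {x : Space n} {t k d : ℝ} {g : Space n} (hk : 0 ≤ k) (hkg : k + ‖g‖ ^ 2 < δ)
    (hq : ∀ v : Space n, ∃ c₀ c₁ c₂ c₃ c₄ : ℝ, (∀ s : ℝ, Φ (x + s • v, t)
      = c₀ + c₁ * s + c₂ * s ^ 2 + c₃ * s ^ 3 + c₄ * s ^ 4) ∧
      -k * ‖v‖ ^ 2 + ⟪g, v⟫ ^ 2 ≤ 2 * c₂)
    (hd : HasDerivAt (fun τ : ℝ => Φ (x, τ)) d t) (hlt : d < lam * ‖g‖ ^ 2 - Lam * k)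
    (M : SymMat n)
    (hM : ∀ i j, (M : Matrix (Fin n) (Fin n) ℝ) i j = spatialHessian Φ x t i j) :
    deriv (fun τ : ℝ => Φ (x, τ)) t < F M := by
  rw [hd.deriv]
  refine hlt.trans_le (hF.lower_bound hn hk hkg fun v => ?_)
  obtain ⟨c₀, c₁, c₂, c₃, c₄, h, h2⟩ := hq v
  rwa [quadForm_hessian hM, fderiv_fderiv_of_quartic (contDiff_slice hΦ t) h]

end Comparison

/-! ### Parabolas and non-strict contact. -/

section Parabolas

variable {n : ℕ}

/-- Non-strict contact from below over the closed ball, at all times up to `t`. -/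
def TouchesBelow (φ v : Space n × ℝ → ℝ) (x : Space n) (t : ℝ) : Prop :=
  (∀ ξ ∈ Metric.closedBall (0 : Space n) 1, ∀ τ ≤ t, φ (ξ, τ) ≤ v (ξ, τ)) ∧ φ (x, t) = v (x, t)

lemma mem_closedBall_of_mem_Q₁ {ξ : Space n} {τ : ℝ} (h : (ξ, τ) ∈ Q₁ n) :
    ξ ∈ Metric.closedBall (0 : Space n) 1 :=
  Metric.ball_subset_closedBall h.1

lemma contDiff_concaveParabola (a : ℝ) (y : Space n) (s : ℝ) :
    ContDiff ℝ ∞ (concaveParabola a y s) := by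
  unfold concaveParabola
  exact (contDiff_const.mul ((contDiff_fst.sub contDiff_const).norm_sq ℝ)).add
    (contDiff_const.mul (contDiff_snd.sub contDiff_const))

lemma norm_add_smul_sub_sq (x y v : Space n) (s : ℝ) :
    ‖x + s • v - y‖ ^ 2 = ‖x - y‖ ^ 2 + 2 * ⟪x - y, v⟫ * s + ‖v‖ ^ 2 * s ^ 2 := by
  have : x + s • v - y = (x - y) + s • v := by abel
  rw [this, norm_add_sq_real, inner_smul_right, norm_smul, mul_pow, Real.norm_eq_abs, sq_abs]
  ring

lemma concaveParabola_line (a : ℝ) (y : Space n) (s : ℝ) (x v : Space n) (t σ : ℝ) :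
    concaveParabola a y s (x + σ • v, t) = concaveParabola a y s (x, t)
      + (-a * ⟪x - y, v⟫) * σ + (-(a / 2) * ‖v‖ ^ 2) * σ ^ 2 := by
  simp only [concaveParabola, norm_add_smul_sub_sq]
  ring

lemma hasDerivAt_concaveParabola (a : ℝ) (y : Space n) (s : ℝ) (x : Space n) (t : ℝ) :
    HasDerivAt (fun τ : ℝ => concaveParabola a y s (x, τ)) a t := by
  simpa [concaveParabola] using
    (((hasDerivAt_id' t).sub_const s).const_mul a).const_add (-(a / 2) * ‖x - y‖ ^ 2)

end Parabolas

/-! ### Comparison in moving tubes. -/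

section Tube

variable {n : ℕ} {F : SymMat n → ℝ} {v : Space n × ℝ → ℝ}

/-- Comparison in a tube `{(ξ, τ) : |ξ - X(τ)| ≤ ρ, t₁ ≤ τ ≤ t₂}`. -/
lemma IsViscositySupersolution.comparison_tube (hv : IsViscositySupersolution F v)
    (hc : ContinuousOn v (Metric.closedBall 0 1 ×ˢ univ)) {X : ℝ → Space n} (hX : Continuous X)
    {ρ t₁ t₂ : ℝ} (hQ : ∀ τ ∈ Icc t₁ t₂, ∀ ξ, ‖ξ - X τ‖ ≤ ρ → (ξ, τ) ∈ Q₁ n)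
    {Φ : Space n × ℝ → ℝ} (hΦ : ContDiff ℝ ∞ Φ)
    (hinit : ∀ ξ, (ξ, t₁) ∈ Q₁ n → ‖ξ - X t₁‖ ≤ ρ → Φ (ξ, t₁) ≤ v (ξ, t₁))
    (hlat : ∀ τ ∈ Icc t₁ t₂, ∀ ξ, (ξ, τ) ∈ Q₁ n → ‖ξ - X τ‖ = ρ → Φ (ξ, τ) ≤ v (ξ, τ))
    (hint : ∀ τ ∈ Ioc t₁ t₂, ∀ ξ, ‖ξ - X τ‖ < ρ → ∀ M : SymMat n,
      (∀ i j, (M : Matrix (Fin n) (Fin n) ℝ) i j = spatialHessian Φ ξ τ i j) →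
        deriv (fun τ : ℝ => Φ (ξ, τ)) τ < F M) :
    ∀ τ ∈ Icc t₁ t₂, ∀ ξ, ‖ξ - X τ‖ ≤ ρ → Φ (ξ, τ) ≤ v (ξ, τ) := by
  set K : Set (Space n × ℝ) := {z | z.2 ∈ Icc t₁ t₂ ∧ ‖z.1 - X z.2‖ ≤ ρ} with hK
  have hKQ : K ⊆ Q₁ n := fun z hz => hQ z.2 hz.1 z.1 hz.2
  have hKb : K ⊆ Metric.closedBall 0 1 ×ˢ Icc t₁ t₂ := fun z hz =>
    ⟨Metric.ball_subset_closedBall (hKQ hz).1, hz.1⟩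
  have hcont : Continuous fun z : Space n × ℝ => ‖z.1 - X z.2‖ :=
    (continuous_fst.sub (hX.comp continuous_snd)).norm
  have hKc : IsCompact K := by
    refine ((isCompact_closedBall _ _).prod isCompact_Icc).of_isClosed_subset ?_ hKb
    exact (isClosed_Icc.preimage continuous_snd).inter (isClosed_le hcont continuous_const)
  have key := hv.comparison hKc
    (hc.mono (hKb.trans (prod_mono_right (subset_univ _)))) hΦ ?_
  · exact fun τ hτ ξ hξ => key (ξ, τ) ⟨hτ, hξ⟩
  rintro ⟨ξ, τ⟩ ⟨hτ, hξ⟩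
  simp only at hτ hξ
  rcases hτ.1.eq_or_lt with h1 | h1
  · subst h1
    exact Or.inl (hinit ξ (hQ _ hτ _ hξ) hξ)
  rcases hξ.eq_or_lt with h2 | h2
  · exact Or.inl (hlat τ hτ ξ (hQ _ hτ _ hξ) h2)
  -- The top face needs no boundary condition, because viscosity tests compare only times up to that
  -- of the contact point.
  refine Or.inr ⟨hQ τ hτ ξ hξ, ?_, hint τ ⟨h1, hτ.2⟩ ξ h2⟩
  have e1 : ∀ᶠ w : Space n × ℝ in 𝓝 (ξ, τ), ‖w.1 - X w.2‖ < ρ :=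
    hcont.continuousAt.eventually_lt continuousAt_const h2
  have e2 : ∀ᶠ w : Space n × ℝ in 𝓝 (ξ, τ), t₁ < w.2 :=
    continuousAt_const.eventually_lt continuous_snd.continuousAt h1
  filter_upwards [e1, e2] with w hw1 hw2 hw3
  exact ⟨⟨hw2.le, hw3.trans hτ.2⟩, hw1.le⟩

end Tube

/-! ### The gap between two touching parabolas of equal opening. -/

section Gap

variable {n : ℕ} {F : SymMat n → ℝ} {v : Space n × ℝ → ℝ} {lam Lam δ : ℝ}

/-- The number of multiples of the scale on which the gap estimate needs the equation. -/
noncomputable def gapRadius (lam Lam : ℝ) : ℝ := 85 * Lam ^ 2 / lam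

/-- The constant in the gradient part of the gap estimate. -/
noncomputable def gapSlope (lam Lam : ℝ) : ℝ := 21 * Lam * gapRadius lam Lam / lam

lemma gapRadius_ge (hlam : 0 < lam) (hlam1 : lam ≤ 1) (hLam : 1 ≤ Lam) :
    85 * Lam ≤ gapRadius lam Lam := by
  rw [gapRadius, le_div_iff₀ hlam]
  nlinarith [mul_le_mul_of_nonneg_left hlam1 (by linarith : (0 : ℝ) ≤ Lam),
    mul_le_mul_of_nonneg_left hLam (by linarith : (0 : ℝ) ≤ Lam)]

lemma gapSlope_ge (hlam : 0 < lam) (hlam1 : lam ≤ 1) (hLam : 1 ≤ Lam) :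
    21 * gapRadius lam Lam ≤ gapSlope lam Lam := by
  have h := gapRadius_ge hlam hlam1 hLam
  have h0 : 0 ≤ gapRadius lam Lam := by linarith
  rw [gapSlope, le_div_iff₀ hlam]
  nlinarith [mul_le_mul_of_nonneg_left hlam1 h0, mul_le_mul_of_nonneg_right hLam h0]

/-- If the affine function `ℓ = ⟨g, · - x₁⟩ - D` is very negative around `x₁`, a supersolution
above `P` up to time `t₁` and above `P + ℓ` up to a slightly later time `t₂` cannot equal `P + ℓ`
at time `t₂`. -/
lemma drop_le (hn : 1 ≤ n) (hLam : 1 ≤ Lam) (hF : StructureConditions lam Lam δ F)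
    (hv : IsViscositySupersolution F v) (hc : ContinuousOn v (Metric.closedBall 0 1 ×ˢ univ))
    {a r : ℝ} (ha : 0 < a) (hr : 0 < r) (hδ : 4 * a < δ) {y : Space n} {s : ℝ} {g : Space n}
    {D : ℝ} {x₁ x₂ : Space n} {t₁ t₂ : ℝ} (ht : t₁ ≤ t₂) (htr : t₂ ≤ t₁ + r ^ 2)
    (hx : ‖x₂ - x₁‖ ≤ r)
    (hroom : ∀ τ ∈ Icc t₁ t₂, ∀ ξ, ‖ξ - x₂‖ ≤ 3 * Lam * r → (ξ, τ) ∈ Q₁ n)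
    (h1 : ∀ ξ ∈ Metric.closedBall (0 : Space n) 1, ∀ τ ≤ t₁, concaveParabola a y s (ξ, τ) ≤ v (ξ, τ))
    (h2 : TouchesBelow (fun z => concaveParabola a y s z + (⟪g, z.1 - x₁⟫ - D)) v x₂ t₂) :
    D ≤ 8 * Lam * ‖g‖ * r ∨ D ≤ 18 * Lam * a * r ^ 2 := by
  by_contra! hcon
  obtain ⟨hD1, hD2⟩ := hcon
  set ρ : ℝ := 3 * Lam * r with hρ
  have hρ0 : 0 < ρ := by positivity
  set D₀ : ℝ := 9 * Lam * a * r ^ 2 with hD₀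
  have hD₀0 : 0 < D₀ := by positivity
  -- If both alternatives fail, `ℓ + D₀ < 0` on the initial ball, so `Φ` starts below `P`. The bump
  -- is nonpositive on the lateral boundary and at least `D₀ / 2` at `(x₂, t₂)`. Its time decay, at
  -- rate `9 Λ a / 2`, pays for its concavity in space and that of `P`.
  set Φ : Space n × ℝ → ℝ := fun z => concaveParabola a y s z + (⟪g, z.1 - x₁⟫ - D)
    + D₀ * (1 - ‖z.1 - x₂‖ ^ 2 / ρ ^ 2 - (z.2 - t₁) / (2 * r ^ 2)) with hΦdef
  have hΦ : ContDiff ℝ ∞ Φ := by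
    refine ((contDiff_concaveParabola a y s).add (ContDiff.sub (contDiff_const.inner ℝ
      (contDiff_fst.sub contDiff_const)) contDiff_const)).add (contDiff_const.mul
      ((contDiff_const.sub (((contDiff_fst.sub contDiff_const).norm_sq ℝ).div_const _)).sub
      ((contDiff_snd.sub contDiff_const).div_const _)))
  have hr2 : D₀ / (2 * r ^ 2) = 9 / 2 * Lam * a := by
    rw [hD₀]; field_simp
  have hρ2 : D₀ / ρ ^ 2 = a / Lam := by
    rw [hD₀, hρ]; field_simp; norm_num
  have haL : a / Lam ≤ a := div_le_self ha.le hLam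
  have key := hv.comparison_tube hc (X := fun _ => x₂) continuous_const hroom hΦ ?_ ?_ ?_ t₂
    ⟨ht, le_rfl⟩ x₂ (by simpa using hρ0.le)
  · have e := h2.2
    simp only [hΦdef] at key e
    rw [← e] at key
    have : (t₂ - t₁) / (2 * r ^ 2) ≤ 1 / 2 := by
      rw [div_le_div_iff₀ (by positivity) (by norm_num)]; linarith
    have h3 : 0 < D₀ * (1 - ‖x₂ - x₂‖ ^ 2 / ρ ^ 2 - (t₂ - t₁) / (2 * r ^ 2)) := by
      refine mul_pos hD₀0 ?_
      simp only [sub_self, norm_zero]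
      norm_num
      linarith
    linarith
  · intro ξ hξ hξ2
    refine le_trans ?_ (h1 ξ (mem_closedBall_of_mem_Q₁ hξ) t₁ le_rfl)
    have e1 : ⟪g, ξ - x₁⟫ ≤ ‖g‖ * (4 * Lam * r) := by
      refine (real_inner_le_norm _ _).trans (mul_le_mul_of_nonneg_left ?_ (norm_nonneg _))
      have : ξ - x₁ = (ξ - x₂) + (x₂ - x₁) := by abel
      rw [this]
      refine (norm_add_le _ _).trans ?_
      nlinarith [mul_le_mul_of_nonneg_right hLam hr.le]
    have e2 : 0 ≤ D₀ * (‖ξ - x₂‖ ^ 2 / ρ ^ 2) := by positivity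
    simp only [hΦdef, sub_self, zero_div]
    nlinarith
  · intro τ hτ ξ hξ hξ2
    refine le_trans ?_ (h2.1 ξ (mem_closedBall_of_mem_Q₁ hξ) τ hτ.2)
    have e3 : 0 ≤ D₀ * ((τ - t₁) / (2 * r ^ 2)) :=
      mul_nonneg hD₀0.le (div_nonneg (by linarith [hτ.1]) (by positivity))
    simp only [hΦdef]
    rw [hξ2, div_self (by positivity)]
    nlinarith
  · intro τ hτ ξ hξ
    refine hF.strict_subsolution hn hΦ (k := a + 2 * (D₀ / ρ ^ 2)) (g := 0)
      (d := a - D₀ / (2 * r ^ 2)) (by positivity) (by rw [hρ2]; simp; linarith) ?_ ?_ ?_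
    · intro w
      refine ⟨Φ (ξ, τ), -a * ⟪ξ - y, w⟫ + ⟪g, w⟫ - D₀ / ρ ^ 2 * (2 * ⟪ξ - x₂, w⟫),
        -(a / 2) * ‖w‖ ^ 2 - D₀ / ρ ^ 2 * ‖w‖ ^ 2, 0, 0, fun σ => ?_, ?_⟩
      · simp only [hΦdef, concaveParabola_line, norm_add_smul_sub_sq]
        rw [show ξ + σ • w - x₁ = (ξ - x₁) + σ • w by abel, inner_add_right, inner_smul_right]
        ring
      · simp only [inner_zero_left]
        apply le_of_eq; ring
    · have := ((hasDerivAt_concaveParabola a y s ξ τ).add_const (⟪g, ξ - x₁⟫ - D)).fun_add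
        ((((((hasDerivAt_id' τ).sub_const t₁).div_const (2 * r ^ 2)).const_sub
          (1 - ‖ξ - x₂‖ ^ 2 / ρ ^ 2))).const_mul D₀)
      refine this.congr_deriv ?_
      ring
    · rw [hr2, hρ2]
      simp only [norm_zero]
      have : Lam * (a / Lam) = a := by field_simp
      nlinarith

set_option maxHeartbeats 600000 in
/-- A supersolution above `max (P, P + ℓ)` with `ℓ = ⟨g, · - x₁⟩ - D` cannot equal `P` at `x₁`
when the slope of `ℓ` is large and its crease passes close to `x₁`. -/
lemma crease_absurd (hn : 1 ≤ n) (hlam : 0 < lam) (hlam1 : lam ≤ 1) (hLam : 1 ≤ Lam)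
    (hF : StructureConditions lam Lam δ F)
    (hv : IsViscositySupersolution F v) (hc : ContinuousOn v (Metric.closedBall 0 1 ×ˢ univ))
    {a r : ℝ} (ha : 0 < a) (hr : 0 < r) (hδ : 14 * Lam / lam * a < δ) {y : Space n} {s : ℝ}
    {g : Space n} {D : ℝ} {x₁ : Space n} {t₁ : ℝ}
    (hroom : ∀ τ ∈ Icc (t₁ - (gapRadius lam Lam * r) ^ 2) t₁, ∀ ξ,
      ‖ξ - x₁‖ ≤ gapRadius lam Lam * r → (ξ, τ) ∈ Q₁ n)
    (h1 : TouchesBelow (concaveParabola a y s) v x₁ t₁)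
    (h2 : ∀ ξ ∈ Metric.closedBall (0 : Space n) 1, ∀ τ ≤ t₁,
      concaveParabola a y s (ξ, τ) + (⟪g, ξ - x₁⟫ - D) ≤ v (ξ, τ))
    (hg : ‖g‖ = gapSlope lam Lam * a * r) (hD0 : 0 ≤ D)
    (hD : D ≤ 8 * Lam * (gapSlope lam Lam * a * r) * r) : False := by
  set m := gapRadius lam Lam with hm
  set C := gapSlope lam Lam with hC
  have hm1 : 85 * Lam ≤ m := gapRadius_ge hlam hlam1 hLam
  have hC1 : 21 * m ≤ C := gapSlope_ge hlam hlam1 hLam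
  have hm0 : 0 < m := by linarith
  have hC0 : 0 < C := by linarith
  have hClam : C * lam = 21 * Lam * m := by
    rw [hC, gapSlope, ← hm]; field_simp
  have hmlam : m * lam = 85 * Lam ^ 2 := by
    rw [hm, gapRadius]; field_simp
  set ρ : ℝ := m * r with hρ
  have hρ0 : 0 < ρ := by positivity
  -- A bound for `|ℓ|` on the ball of radius `ρ` about `x₁`.
  set q : ℝ := (m + 8 * Lam) * C * a * r ^ 2 with hq
  have hq0 : 0 < q := by positivity
  set ℓ : Space n → ℝ := fun ξ => ⟪g, ξ - x₁⟫ - D with hℓ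
  -- For `|ℓ| ≤ q` the quadratic `ℓ² / (4q) + ℓ / 2` stays below `max (0, ℓ)`. Its Hessian `g ⊗ g /
  -- (2q)` has size `C a / (2 (m + 8 Λ))`, enough to pay for the last two terms, which are
  -- nonpositive together on the parabolic boundary but add `a ρ²` at `(x₁, t₁)`.
  set Φ : Space n × ℝ → ℝ := fun z => concaveParabola a y s z
    + (ℓ z.1 ^ 2 / (4 * q) + ℓ z.1 / 2) - a * ‖z.1 - x₁‖ ^ 2 + a * (z.2 - (t₁ - ρ ^ 2)) with hΦdef
  have hℓc : ContDiff ℝ ∞ fun z : Space n × ℝ => ℓ z.1 :=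
    ContDiff.sub (contDiff_const.inner ℝ (contDiff_fst.sub contDiff_const)) contDiff_const
  have hΦ : ContDiff ℝ ∞ Φ := by
    refine (((contDiff_concaveParabola a y s).add (((hℓc.pow 2).div_const _).add
      (hℓc.div_const _))).sub (contDiff_const.mul ((contDiff_fst.sub contDiff_const).norm_sq ℝ))).add
      (contDiff_const.mul (contDiff_snd.sub contDiff_const))
  have hcrease : ∀ τ ≤ t₁, ∀ ξ, (ξ, τ) ∈ Q₁ n → ‖ξ - x₁‖ ≤ ρ →
      concaveParabola a y s (ξ, τ) + (ℓ ξ ^ 2 / (4 * q) + ℓ ξ / 2) ≤ v (ξ, τ) := by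
    intro τ hτ ξ hξ hξ2
    have b1 := h1.1 ξ (mem_closedBall_of_mem_Q₁ hξ) τ hτ
    have b2 : concaveParabola a y s (ξ, τ) + ℓ ξ ≤ v (ξ, τ) := h2 ξ (mem_closedBall_of_mem_Q₁ hξ) τ hτ
    have b3 : |⟪g, ξ - x₁⟫| ≤ C * a * r * (m * r) := by
      refine (abs_real_inner_le_norm _ _).trans ?_
      rw [hg]
      exact mul_le_mul_of_nonneg_left hξ2 (by positivity)
    have b4 : |ℓ ξ| ≤ q := by
      rw [abs_le] at b3 ⊢
      constructor <;> simp only [hℓ, hq] <;> nlinarith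
    rw [abs_le] at b4
    have b5 : ℓ ξ ^ 2 / (4 * q) ≤ |ℓ ξ| / 2 := by
      rw [div_le_div_iff₀ (by positivity) (by norm_num)]
      rcases le_total 0 (ℓ ξ) with h | h
      · rw [abs_of_nonneg h]; nlinarith
      · rw [abs_of_nonpos h]; nlinarith
    rcases le_total 0 (ℓ ξ) with h | h
    · rw [abs_of_nonneg h] at b5; linarith
    · rw [abs_of_nonpos h] at b5; linarith
  have key := hv.comparison_tube hc (X := fun _ => x₁) continuous_const hroom hΦ ?_ ?_ ?_ t₁
    ⟨by nlinarith, le_rfl⟩ x₁ (by simpa using hρ0.le)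
  · rw [← h1.2] at key
    simp only [hΦdef, hℓ, sub_self, norm_zero, inner_zero_right] at key
    have e1 : 0 ≤ (0 - D) ^ 2 / (4 * q) := by positivity
    have e2 : D / 2 < a * ρ ^ 2 := by
      -- After multiplication by `lam` this is `84 Λ² m < 85 Λ² m`, where `84 = 4 * 21` combines the
      -- constants of `gapSlope` and `gapRadius`.
      have : 4 * Lam * C < m ^ 2 := by
        have h3 : 4 * Lam * C * lam < m ^ 2 * lam := by
          have : m ^ 2 * lam = m * (85 * Lam ^ 2) := by rw [← hmlam]; ring
          rw [this, show 4 * Lam * C * lam = 4 * Lam * (C * lam) by ring, hClam]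
          have : 0 < m * Lam ^ 2 := by positivity
          nlinarith
        exact lt_of_mul_lt_mul_right h3 hlam.le
      have h4 : 4 * Lam * C * (a * r ^ 2) < m ^ 2 * (a * r ^ 2) :=
        mul_lt_mul_of_pos_right this (by positivity)
      rw [hρ]; nlinarith
    nlinarith
  · intro ξ hξ hξ2
    refine le_trans ?_ (hcrease (t₁ - ρ ^ 2) (by nlinarith) ξ hξ hξ2)
    simp only [hΦdef, sub_self, mul_zero]
    have : 0 ≤ a * ‖ξ - x₁‖ ^ 2 := by positivity
    linarith
  · intro τ hτ ξ hξ hξ2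
    refine le_trans ?_ (hcrease τ hτ.2 ξ hξ hξ2.le)
    simp only [hΦdef]
    rw [hξ2]
    have := mul_le_mul_of_nonneg_left hτ.2 ha.le
    linarith
  · intro τ hτ ξ hξ
    have hG : ‖(Real.sqrt (1 / (2 * q))) • g‖ ^ 2 = C * a / (2 * (m + 8 * Lam)) := by
      rw [norm_smul, mul_pow, Real.norm_eq_abs, sq_abs, Real.sq_sqrt (by positivity), hg, hq]
      field_simp
    have hG2 : lam * (C * a / (2 * (m + 8 * Lam))) = 21 * Lam * m * a / (2 * (m + 8 * Lam)) := by
      rw [← hClam]; ring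
    have hG3 : 5 * Lam * a < 21 * Lam * m * a / (2 * (m + 8 * Lam)) := by
      rw [lt_div_iff₀ (by positivity)]
      have : 0 < Lam * a := by positivity
      nlinarith
    have hG4 : C * a / (2 * (m + 8 * Lam)) ≤ 21 / 2 * (Lam / lam * a) := by
      rw [div_le_iff₀ (by positivity)]
      have e : C = 21 * m * (Lam / lam) := by
        field_simp; linarith
      rw [e]
      have : 0 ≤ Lam / lam * a := by positivity
      nlinarith
    have hG5 : a ≤ Lam / lam * a := by
      have : 1 ≤ Lam / lam := by rw [le_div_iff₀ hlam]; linarith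
      nlinarith
    refine hF.strict_subsolution hn hΦ (k := 3 * a) (g := (Real.sqrt (1 / (2 * q))) • g)
      (d := 2 * a) (by positivity) ?_ ?_ ?_ ?_
    · rw [hG]
      have : 14 * Lam / lam * a = 14 * (Lam / lam * a) := by ring
      linarith
    · intro w
      refine ⟨Φ (ξ, τ), -a * ⟪ξ - y, w⟫ + (2 * ℓ ξ * ⟪g, w⟫ / (4 * q) + ⟪g, w⟫ / 2)
        - a * (2 * ⟪ξ - x₁, w⟫),
        -(a / 2) * ‖w‖ ^ 2 + ⟪g, w⟫ ^ 2 / (4 * q) - a * ‖w‖ ^ 2, 0, 0, fun σ => ?_, ?_⟩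
      · have e : ℓ (ξ + σ • w) = ℓ ξ + σ * ⟪g, w⟫ := by
          simp only [hℓ]
          rw [show ξ + σ • w - x₁ = (ξ - x₁) + σ • w by abel, inner_add_right, inner_smul_right]
          ring
        simp only [hΦdef, concaveParabola_line, norm_add_smul_sub_sq, e]
        ring
      · rw [real_inner_smul_left, mul_pow, Real.sq_sqrt (by positivity)]
        apply le_of_eq; field_simp; ring
    · have := (((hasDerivAt_concaveParabola a y s ξ τ).add_const
        (ℓ ξ ^ 2 / (4 * q) + ℓ ξ / 2)).sub_const (a * ‖ξ - x₁‖ ^ 2)).fun_add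
        (((hasDerivAt_id' τ).sub_const (t₁ - ρ ^ 2)).const_mul a)
      refine this.congr_deriv ?_
      ring
    · rw [hG, hG2]
      nlinarith

/-- The gap estimate: two parabolas of the same opening touching a supersolution from below at
points at parabolic distance `r` differ near these points by an affine function of size `r²`. -/
lemma touching_gap (hn : 1 ≤ n) (hlam : 0 < lam) (hlam1 : lam ≤ 1) (hLam : 1 ≤ Lam)
    (hF : StructureConditions lam Lam δ F)
    (hv : IsViscositySupersolution F v) (hc : ContinuousOn v (Metric.closedBall 0 1 ×ˢ univ))
    {a r : ℝ} (ha : 0 < a) (hr : 0 < r) (hδ : 14 * Lam / lam * a < δ) {y : Space n} {s : ℝ}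
    {g : Space n} {D : ℝ} {x₁ x₂ : Space n} {t₁ t₂ : ℝ} (ht : t₁ ≤ t₂) (htr : t₂ ≤ t₁ + r ^ 2)
    (hx : ‖x₂ - x₁‖ ≤ r)
    (hroom : ∀ τ ∈ Icc (t₁ - (gapRadius lam Lam * r) ^ 2) t₂, ∀ ξ,
      ‖ξ - x₁‖ ≤ gapRadius lam Lam * r → (ξ, τ) ∈ Q₁ n)
    (h1 : TouchesBelow (concaveParabola a y s) v x₁ t₁)
    (h2 : TouchesBelow (fun z => concaveParabola a y s z + (⟪g, z.1 - x₁⟫ - D)) v x₂ t₂) :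
    ‖g‖ ≤ gapSlope lam Lam * a * r ∧ 0 ≤ D ∧ D ≤ 8 * Lam * (gapSlope lam Lam * a * r) * r := by
  set m := gapRadius lam Lam with hm
  set C := gapSlope lam Lam with hC
  have hm1 : 85 * Lam ≤ m := gapRadius_ge hlam hlam1 hLam
  have hC1 : 21 * m ≤ C := gapSlope_ge hlam hlam1 hLam
  have hC0 : 0 < C := by linarith
  have hx1 : x₁ ∈ Metric.closedBall (0 : Space n) 1 := by
    refine Metric.ball_subset_closedBall (hroom t₁ ⟨by nlinarith, ht⟩ x₁ ?_).1
    simp only [sub_self, norm_zero]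
    exact mul_nonneg (by linarith) hr.le
  have hD0 : 0 ≤ D := by
    have := h2.1 x₁ hx1 t₁ ht
    rw [← h1.2] at this
    simp only [sub_self, inner_zero_right] at this
    linarith
  have hG5 : a ≤ Lam / lam * a := by
    have : 1 ≤ Lam / lam := by rw [le_div_iff₀ hlam]; linarith
    nlinarith
  have hδ' : 14 * (Lam / lam * a) < δ := by
    have : 14 * Lam / lam * a = 14 * (Lam / lam * a) := by ring
    linarith
  have hdrop := drop_le hn hLam hF hv hc ha hr (by linarith) ht htr hx
    (fun τ hτ ξ hξ => hroom τ ⟨by nlinarith [hτ.1, sq_nonneg (m * r)], hτ.2⟩ ξ (by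
      have : ξ - x₁ = (ξ - x₂) + (x₂ - x₁) := by abel
      rw [this]
      refine (norm_add_le _ _).trans ?_
      nlinarith [mul_le_mul_of_nonneg_right hLam hr.le, mul_le_mul_of_nonneg_right hm1 hr.le]))
    h1.1 h2
  have hLr : 18 * Lam * a * r ^ 2 ≤ 8 * Lam * (C * a * r) * r := by
    have : 0 < Lam * a * r ^ 2 := by positivity
    nlinarith
  by_cases hg : ‖g‖ ≤ C * a * r
  · refine ⟨hg, hD0, ?_⟩
    rcases hdrop with h | h
    · refine h.trans (mul_le_mul_of_nonneg_right (mul_le_mul_of_nonneg_left hg ?_) hr.le)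
      linarith
    · linarith
  exfalso
  push Not at hg
  have hCar : 0 < C * a * r := by positivity
  have hgpos : 0 < ‖g‖ := hCar.trans hg
  -- `P + κ ℓ` is a convex combination of `P` and `P + ℓ`, hence still below `v`; `κ` lowers the
  -- slope exactly to the threshold.
  set κ := C * a * r / ‖g‖ with hκ
  have hκ0 : 0 < κ := by positivity
  have hκ1 : κ < 1 := (div_lt_one hgpos).2 hg
  have hκg : κ * ‖g‖ = C * a * r := by rw [hκ]; field_simp
  refine crease_absurd hn hlam hlam1 hLam hF hv hc ha hr hδ (g := κ • g) (D := κ * D)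
    (fun τ hτ => hroom τ ⟨hτ.1, hτ.2.trans ht⟩) h1 ?_ ?_ (by positivity) ?_
  · intro ξ hξ τ hτ
    have e1 := h1.1 ξ hξ τ hτ
    have e2 := h2.1 ξ hξ τ (hτ.trans ht)
    simp only at e2
    rw [real_inner_smul_left]
    nlinarith
  · rw [norm_smul, Real.norm_eq_abs, abs_of_pos hκ0, hκg]
  · rcases hdrop with h | h
    · calc κ * D ≤ κ * (8 * Lam * ‖g‖ * r) := mul_le_mul_of_nonneg_left h hκ0.le
        _ = 8 * Lam * (κ * ‖g‖) * r := by ring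
        _ = _ := by rw [hκg]
    · calc κ * D ≤ 1 * D := mul_le_mul_of_nonneg_right hκ1.le hD0
        _ ≤ _ := by linarith

end Gap

/-! ### Backward growth by a moving barrier. -/

section Barrier

variable {n : ℕ} {F : SymMat n → ℝ} {v : Space n × ℝ → ℝ} {lam Lam δ : ℝ}

/-- The decay rate of the moving barrier. -/
noncomputable def barrierRate (lam Lam : ℝ) : ℝ := 49 * Lam ^ 2 / (4 * lam)

/-- The constant in the backward growth estimate. -/
noncomputable def growthConst (lam Lam : ℝ) : ℝ :=
  Lam / lam * Real.exp (600 * barrierRate lam Lam)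

lemma barrierRate_pos (hlam : 0 < lam) (hLam : 1 ≤ Lam) : 0 < barrierRate lam Lam := by
  unfold barrierRate; positivity

lemma one_le_growthConst (hlam : 0 < lam) (hlam1 : lam ≤ 1) (hLam : 1 ≤ Lam) :
    1 ≤ growthConst lam Lam := by
  have h1 : 1 ≤ Lam / lam := by rw [le_div_iff₀ hlam]; linarith
  have h2 : 1 ≤ Real.exp (600 * barrierRate lam Lam) :=
    Real.one_le_exp (by have := barrierRate_pos hlam hLam; positivity)
  exact one_le_mul_of_one_le_of_one_le h1 h2

/-- The profile inequality behind the barrier, where `q = 1 - |η|²`. -/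
lemma barrier_profile (hlam : 0 < lam) (hlam1 : lam ≤ 1) (hLam : 1 ≤ Lam) {q w : ℝ} (hq : 0 ≤ q)
    (hw : w ≤ 2 / 5) :
    4 * lam ≤ 8 * lam * (1 - q) - 4 * Lam * q + barrierRate lam Lam * q ^ 2 - 4 * q * w := by
  have h1 : 4 * q * w ≤ 8 / 5 * Lam * q := by
    have := mul_le_mul_of_nonneg_left hw hq
    nlinarith
  have h2 : 8 * lam * q ≤ 8 * Lam * q := by nlinarith
  -- `barrierRate` makes the difference a perfect square; the coefficient 14 covers `8 + 4 + 8/5`.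
  have h3 : 14 * Lam * q ≤ 4 * lam + barrierRate lam Lam * q ^ 2 := by
    have : 4 * lam + barrierRate lam Lam * q ^ 2 - 14 * Lam * q
        = (4 * lam - 7 * Lam * q) ^ 2 / (4 * lam) := by
      unfold barrierRate; field_simp; ring
    have h4 : 0 ≤ (4 * lam - 7 * Lam * q) ^ 2 / (4 * lam) := by positivity
    linarith
  have h5 : 0 ≤ Lam * q := mul_nonneg (by linarith) hq
  linarith

/-- Backward growth estimate: below a contact point, along a tube leading to it, the supersolution
comes close to the touching parabola somewhere at the bottom of the tube. -/
lemma exists_near_touching (hn : 1 ≤ n) (hlam : 0 < lam) (hlam1 : lam ≤ 1) (hLam : 1 ≤ Lam)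
    (hF : StructureConditions lam Lam δ F)
    (hv : IsViscositySupersolution F v) (hc : ContinuousOn v (Metric.closedBall 0 1 ×ˢ univ))
    {a ρ : ℝ} (ha : 0 < a) (hρ : 0 < ρ) (hδ : 13 * growthConst lam Lam * a < δ)
    {y : Space n} {s : ℝ} {x₁ c₀ c₁ : Space n} {t₀ t₁ : ℝ} (ht : t₀ < t₁)
    (hT : t₁ - t₀ ≤ 600 * ρ ^ 2) (hspeed : ‖c₁ - c₀‖ * ρ ≤ 2 / 5 * (t₁ - t₀))
    (hx : ‖x₁ - c₁‖ < ρ)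
    (hroom : ∀ τ ∈ Icc t₀ t₁, ∀ ξ, ‖ξ - (c₀ + ((τ - t₀) / (t₁ - t₀)) • (c₁ - c₀))‖ ≤ ρ →
      (ξ, τ) ∈ Q₁ n)
    (h1 : TouchesBelow (concaveParabola a y s) v x₁ t₁) :
    ∃ x₂, ‖x₂ - c₀‖ ≤ ρ ∧
      v (x₂, t₀) ≤ concaveParabola a y s (x₂, t₀) + growthConst lam Lam * a * ρ ^ 2 := by
  by_contra! hcon
  set G := growthConst lam Lam with hG
  have hG1 : 1 ≤ G := one_le_growthConst hlam hlam1 hLam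
  set μ := barrierRate lam Lam with hμ
  have hμ0 : 0 < μ := barrierRate_pos hlam hLam
  have hT0 : 0 < t₁ - t₀ := by linarith
  set V : Space n := (t₁ - t₀)⁻¹ • (c₁ - c₀) with hV
  set X : ℝ → Space n := fun τ => c₀ + ((τ - t₀) / (t₁ - t₀)) • (c₁ - c₀) with hX
  have hXd : ContDiff ℝ ∞ X :=
    contDiff_const.add (((contDiff_id.sub contDiff_const).div_const _).smul contDiff_const)
  have hXder : ∀ τ, HasDerivAt X V τ := fun τ => by
    have := ((((hasDerivAt_id' τ).sub_const t₀).div_const (t₁ - t₀)).smul_const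
      (c₁ - c₀)).const_add c₀
    simpa [hV, hX] using this
  set A : ℝ := G * a * ρ ^ 2 with hA
  have hA0 : 0 < A := by positivity
  set e : ℝ → ℝ := fun τ => A * Real.exp (-(μ / ρ ^ 2) * (τ - t₀)) with he
  have hed : ContDiff ℝ ∞ e := by
    rw [he]; fun_prop
  have heder : ∀ τ, HasDerivAt e (-(μ / ρ ^ 2) * e τ) τ := fun τ => by
    have := ((((hasDerivAt_id' τ).sub_const t₀).const_mul (-(μ / ρ ^ 2))).exp).const_mul A
    refine this.congr_deriv ?_
    simp only [he]; ring
  have he0 : ∀ τ, 0 < e τ := fun τ => by simp only [he]; positivity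
  have heA : ∀ τ, t₀ ≤ τ → e τ ≤ A := fun τ hτ => by
    simp only [he]
    refine mul_le_of_le_one_right hA0.le (Real.exp_le_one_iff.2 ?_)
    have : 0 ≤ μ / ρ ^ 2 * (τ - t₀) := mul_nonneg (by positivity) (by linarith)
    linarith
  -- The factor `exp (600 μ)` in `growthConst` keeps the amplitude at least `(Λ/λ) a ρ²` throughout
  -- the height `600 ρ²`; this absorbs the contribution of `P` to the inequality.
  have heL : ∀ τ ≤ t₁, Lam / lam * a * ρ ^ 2 ≤ e τ := fun τ hτ => by
    simp only [he, hA, hG, growthConst]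
    have h2 : 1 ≤ Real.exp (600 * μ) * Real.exp (-(μ / ρ ^ 2) * (τ - t₀)) := by
      rw [← Real.exp_add]
      refine Real.one_le_exp ?_
      have : μ / ρ ^ 2 * (τ - t₀) ≤ 600 * μ := by
        rw [div_mul_eq_mul_div, div_le_iff₀ (by positivity)]
        nlinarith
      linarith
    have h3 : 0 ≤ Lam / lam * a * ρ ^ 2 := by positivity
    calc Lam / lam * a * ρ ^ 2 ≤ Lam / lam * a * ρ ^ 2 *
          (Real.exp (600 * μ) * Real.exp (-(μ / ρ ^ 2) * (τ - t₀))) := le_mul_of_one_le_right h3 h2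
      _ = _ := by ring
  -- Near the lateral boundary, where the bump vanishes, its radial second derivative makes `Φ` a
  -- strict subsolution; near the axis the exponential decay does.
  set Φ : Space n × ℝ → ℝ := fun z => concaveParabola a y s z
    + e z.2 * (1 - ‖z.1 - X z.2‖ ^ 2 / ρ ^ 2) ^ 2 with hΦdef
  have hΦ : ContDiff ℝ ∞ Φ :=
    (contDiff_concaveParabola a y s).add ((hed.comp contDiff_snd).mul
      ((contDiff_const.sub (((contDiff_fst.sub (hXd.comp contDiff_snd)).norm_sq ℝ).div_const _)).pow
        2))
  have hX1 : X t₁ = c₁ := by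
    simp [hX, div_self hT0.ne']
  have hX0 : X t₀ = c₀ := by
    simp [hX]
  have key := hv.comparison_tube hc (X := X) hXd.continuous hroom hΦ ?_ ?_ ?_ t₁
    ⟨ht.le, le_rfl⟩ x₁ (by rw [hX1]; exact hx.le)
  · rw [← h1.2] at key
    simp only [hΦdef, hX1] at key
    have h2 : ‖x₁ - c₁‖ ^ 2 / ρ ^ 2 < 1 := by
      rw [div_lt_one (by positivity)]
      exact pow_lt_pow_left₀ hx (norm_nonneg _) two_ne_zero
    have h3 : 0 < e t₁ * (1 - ‖x₁ - c₁‖ ^ 2 / ρ ^ 2) ^ 2 :=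
      mul_pos (he0 _) (pow_pos (by linarith) 2)
    linarith
  · intro ξ hξ hξ2
    rw [hX0] at hξ2
    refine le_trans ?_ (hcon ξ hξ2).le
    simp only [hΦdef, hX0]
    have h2 : ‖ξ - c₀‖ ^ 2 / ρ ^ 2 ≤ 1 := by
      rw [div_le_one (by positivity)]
      exact pow_le_pow_left₀ (norm_nonneg _) hξ2 2
    have h3 : 0 ≤ ‖ξ - c₀‖ ^ 2 / ρ ^ 2 := by positivity
    have h4 : e t₀ * (1 - ‖ξ - c₀‖ ^ 2 / ρ ^ 2) ^ 2 ≤ A * 1 :=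
      mul_le_mul (heA _ le_rfl) (by nlinarith) (by positivity) hA0.le
    linarith
  · intro τ hτ ξ hξ hξ2
    refine le_trans ?_ (h1.1 ξ (mem_closedBall_of_mem_Q₁ hξ) τ hτ.2)
    simp only [hΦdef]
    rw [hξ2, div_self (by positivity)]
    simp
  · intro τ hτ ξ hξ
    set p : ℝ := ‖ξ - X τ‖ ^ 2 / ρ ^ 2 with hp
    have hp0 : 0 ≤ p := by positivity
    have hp1 : p ≤ 1 := by
      rw [hp, div_le_one (by positivity)]
      exact pow_le_pow_left₀ (norm_nonneg _) hξ.le 2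
    set E : ℝ := e τ / ρ ^ 2 with hE
    have hE0 : 0 < E := div_pos (he0 τ) (by positivity)
    have hEa : E ≤ G * a := by
      rw [hE, div_le_iff₀ (by positivity)]
      exact heA τ hτ.1.le
    have hEL : Lam * a ≤ lam * E := by
      have h2 : Lam / lam * a ≤ E := by
        rw [hE, le_div_iff₀ (by positivity)]
        exact heL τ hτ.2
      have h3 := mul_le_mul_of_nonneg_left h2 hlam.le
      have h4 : lam * (Lam / lam * a) = Lam * a := by field_simp
      linarith
    have hinner : ⟪ξ - X τ, V⟫ ≤ 2 / 5 := by
      refine (real_inner_le_norm _ _).trans ?_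
      rw [hV, norm_smul, Real.norm_eq_abs, abs_inv, abs_of_pos hT0, ← mul_assoc,
        mul_comm ‖ξ - X τ‖, mul_assoc, inv_mul_le_iff₀ hT0]
      have : ‖ξ - X τ‖ * ‖c₁ - c₀‖ ≤ ρ * ‖c₁ - c₀‖ :=
        mul_le_mul_of_nonneg_right hξ.le (norm_nonneg _)
      linarith
    have hg : ‖(Real.sqrt (8 * e τ) / ρ ^ 2) • (ξ - X τ)‖ ^ 2 = 8 * E * p := by
      rw [norm_smul, mul_pow, Real.norm_eq_abs, sq_abs, div_pow,
        Real.sq_sqrt (by have := he0 τ; positivity), hp, hE]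
      field_simp
    refine hF.strict_subsolution hn hΦ (k := a + 4 * (1 - p) * E)
      (g := (Real.sqrt (8 * e τ) / ρ ^ 2) • (ξ - X τ))
      (d := a + (-(μ / ρ ^ 2) * e τ * (1 - p) ^ 2
        + e τ * (2 * (1 - p) * (2 * ⟪ξ - X τ, V⟫ / ρ ^ 2)))) ?_ ?_ ?_ ?_ ?_
    · have : 0 ≤ (1 - p) * E := mul_nonneg (by linarith) hE0.le
      linarith
    · rw [hg]
      have h2 : a ≤ G * a := le_mul_of_one_le_left ha.le hG1
      nlinarith
    · intro w
      refine ⟨Φ (ξ, τ), -a * ⟪ξ - y, w⟫ - e τ * (2 * (1 - p) * (2 * ⟪ξ - X τ, w⟫ / ρ ^ 2)),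
        -(a / 2) * ‖w‖ ^ 2 + e τ * (-2 * (1 - p) * (‖w‖ ^ 2 / ρ ^ 2)
          + 4 * ⟪ξ - X τ, w⟫ ^ 2 / ρ ^ 4), e τ * (4 * ⟪ξ - X τ, w⟫ * ‖w‖ ^ 2 / ρ ^ 4),
        e τ * (‖w‖ ^ 4 / ρ ^ 4), fun σ => ?_, ?_⟩
      · simp only [hΦdef, concaveParabola_line, norm_add_smul_sub_sq, hp]
        field_simp
        ring
      · rw [real_inner_smul_left, mul_pow, div_pow,
          Real.sq_sqrt (by have := he0 τ; positivity), hE]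
        apply le_of_eq
        field_simp
        ring
    · have h2 : HasDerivAt (fun τ => ‖ξ - X τ‖ ^ 2) (2 * ⟪ξ - X τ, -V⟫) τ :=
        ((hXder τ).const_sub ξ).norm_sq
      have h3 := (hasDerivAt_concaveParabola a y s ξ τ).fun_add ((heder τ).fun_mul
        (((h2.div_const (ρ ^ 2)).const_sub 1).fun_pow 2))
      refine h3.congr_deriv ?_
      rw [inner_neg_right]
      simp only [hp]
      push_cast
      ring
    · rw [hg]
      have h2 := barrier_profile hlam hlam1 hLam (q := 1 - p) (by linarith) hinner
      have h3 := mul_le_mul_of_nonneg_left h2 hE0.le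
      have h4 : -(μ / ρ ^ 2) * e τ * (1 - p) ^ 2
          + e τ * (2 * (1 - p) * (2 * ⟪ξ - X τ, V⟫ / ρ ^ 2))
          = E * (-(μ * (1 - p) ^ 2) + 4 * (1 - p) * ⟪ξ - X τ, V⟫) := by
        rw [hE]; field_simp; ring
      rw [h4]
      have h5 : a ≤ Lam * a := le_mul_of_one_le_left ha.le hLam
      have h6 : 0 < Lam * a := by positivity
      nlinarith

end Barrier

/-! ### Sliding and the algebra of parabolas. -/

section Sliding

variable {n : ℕ} {v : Space n × ℝ → ℝ}

/-- Contact is tested on the open ball and strictly before `t`; continuity carries the inequality to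
the lateral boundary and to time `t`, which compactness arguments need. -/
lemma le_on_closed_cylinder (hc : ContinuousOn v (Metric.closedBall 0 1 ×ˢ univ))
    {φ : Space n × ℝ → ℝ} (hφ : Continuous φ) {t : ℝ}
    (h : ∀ ξ ∈ Metric.ball (0 : Space n) 1, ∀ τ < t, φ (ξ, τ) ≤ v (ξ, τ)) :
    ∀ ξ ∈ Metric.closedBall (0 : Space n) 1, ∀ τ ≤ t, φ (ξ, τ) ≤ v (ξ, τ) := by
  intro ξ hξ τ hτ
  have hcl : closure (Metric.ball (0 : Space n) 1 ×ˢ Iio t)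
      = Metric.closedBall (0 : Space n) 1 ×ˢ Iic t := by
    rw [closure_prod_eq, closure_ball _ one_ne_zero, closure_Iio]
  refine le_on_closure (s := Metric.ball (0 : Space n) 1 ×ˢ Iio t) (f := φ) (g := v)
    (fun z hz => h z.1 hz.1 z.2 hz.2) hφ.continuousOn ?_ (x := (ξ, τ)) ?_
  · rw [hcl]; exact hc.mono (prod_mono_right (subset_univ _))
  · rw [hcl]; exact ⟨hξ, hτ⟩

/-- Sliding: a function pushed above a supporting function touches at a first time. -/
lemma exists_touching (hc : ContinuousOn v (Metric.closedBall 0 1 ×ˢ univ))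
    {φ E : Space n × ℝ → ℝ} (hφ : Continuous φ) (hE : Continuous E) {s t : ℝ} (hst : s ≤ t)
    (h1 : ∀ ξ ∈ Metric.closedBall (0 : Space n) 1, ∀ τ ≤ t, φ (ξ, τ) ≤ v (ξ, τ))
    (h2 : ∀ ξ, ∀ τ ≤ s, E (ξ, τ) ≤ 0) {x : Space n} (hx : x ∈ Metric.closedBall (0 : Space n) 1)
    (h3 : v (x, t) ≤ φ (x, t) + E (x, t)) :
    ∃ ξ ∈ Metric.closedBall (0 : Space n) 1, ∃ τ ∈ Icc s t, 0 ≤ E (ξ, τ) ∧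
      TouchesBelow (fun z => φ z + E z) v ξ τ := by
  set K : Set (Space n × ℝ) := Metric.closedBall 0 1 ×ˢ Icc s t with hK
  have hKc : IsCompact K := (isCompact_closedBall _ _).prod isCompact_Icc
  have hvK : ContinuousOn v K := hc.mono (prod_mono_right (subset_univ _))
  set S : Set (Space n × ℝ) := {z | z ∈ K ∧ v z ≤ φ z + E z} with hS
  have hSc : IsCompact S := by
    refine hKc.of_isClosed_subset ?_ (fun z hz => hz.1)
    exact hKc.isClosed.isClosed_le hvK (hφ.add hE).continuousOn
  obtain ⟨m, hm, hmin⟩ := hSc.exists_isMinOn ⟨(x, t), ⟨hx, hst, le_rfl⟩, h3⟩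
    continuous_snd.continuousOn
  have hmin' : ∀ w ∈ S, m.2 ≤ w.2 := fun w hw => hmin hw
  have hm1 : m.1 ∈ Metric.closedBall (0 : Space n) 1 := hm.1.1
  have hm2 : m.2 ∈ Icc s t := hm.1.2
  -- Up to time `s` the perturbation is nonpositive; after `s`, a crossing before `m.2` would be an
  -- earlier point of `S`.
  have hbelow := le_on_closed_cylinder hc (φ := fun z => φ z + E z) (hφ.add hE) (t := m.2) fun ξ hξ τ hτ => by
    have hξ' := Metric.ball_subset_closedBall hξ
    rcases le_total τ s with h | h
    · linarith [h1 ξ hξ' τ (hτ.le.trans hm2.2), h2 ξ τ h]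
    · by_contra! hlt
      have := hmin' (ξ, τ) ⟨⟨hξ', h, hτ.le.trans hm2.2⟩, hlt.le⟩
      exact absurd hτ (not_lt.2 this)
  have e1 := hm.2
  have e2 : φ m + E m ≤ v m := hbelow m.1 hm1 m.2 le_rfl
  have e3 : φ m ≤ v m := h1 m.1 hm1 m.2 hm2.2
  exact ⟨m.1, hm1, m.2, hm2, by change 0 ≤ E m; linarith, hbelow, by
    change φ m + E m = v m; linarith⟩

/-- The sum of two concave parabolas is a concave parabola. -/
lemma concaveParabola_add {a b : ℝ} (hab : a + b ≠ 0) (y y' : Space n) (s s' : ℝ)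
    (z : Space n × ℝ) :
    concaveParabola a y s z + concaveParabola b y' s' z =
      concaveParabola (a + b) ((a + b)⁻¹ • (a • y + b • y'))
        ((a * s + b * s') / (a + b) + a * b / (2 * (a + b) ^ 2) * ‖y - y'‖ ^ 2) z := by
  obtain ⟨ξ, τ⟩ := z
  have e1 : ‖ξ - (a + b)⁻¹ • (a • y + b • y')‖ ^ 2
      = (a * ‖ξ - y‖ ^ 2 + b * ‖ξ - y'‖ ^ 2) / (a + b)
        - a * b / (a + b) ^ 2 * ‖y - y'‖ ^ 2 := by
    have h1 : ξ - (a + b)⁻¹ • (a • y + b • y') = (a + b)⁻¹ • (a • (ξ - y) + b • (ξ - y')) := by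
      have : ξ = (a + b)⁻¹ • ((a + b) • ξ) := by rw [smul_smul, inv_mul_cancel₀ hab, one_smul]
      nth_rewrite 1 [this]
      rw [← smul_sub]
      congr 1
      module
    have h2 : y - y' = (ξ - y') - (ξ - y) := by abel
    rw [h1, h2]
    generalize ξ - y = p
    generalize ξ - y' = q
    rw [norm_smul, mul_pow, Real.norm_eq_abs, sq_abs, norm_add_sq_real, norm_sub_sq_real,
      norm_smul, norm_smul, mul_pow, mul_pow, Real.norm_eq_abs, Real.norm_eq_abs, sq_abs, sq_abs,
      real_inner_smul_left, real_inner_smul_right, real_inner_comm p q]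
    field_simp
    ring
  simp only [concaveParabola, e1]
  field_simp
  ring

/-- Two concave parabolas of the same opening differ by an affine function of the space variable. -/
lemma concaveParabola_eq_add_affine (b : ℝ) (y y' x : Space n) (s s' : ℝ) (z : Space n × ℝ) :
    concaveParabola b y' s' z = concaveParabola b y s z + (⟪b • (y' - y), z.1 - x⟫
      - (concaveParabola b y s (x, 0) - concaveParabola b y' s' (x, 0))) := by
  obtain ⟨ξ, τ⟩ := z
  simp only [concaveParabola]
  have h1 : ξ - y = (ξ - x) + (x - y) := by abel
  have h2 : ξ - y' = (ξ - x) + (x - y') := by abel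
  have h3 : y' - y = (x - y) - (x - y') := by abel
  rw [h1, h2, h3]
  generalize ξ - x = w
  generalize x - y = p
  generalize x - y' = q
  rw [norm_add_sq_real, norm_add_sq_real, real_inner_smul_left, inner_sub_left,
    real_inner_comm w p, real_inner_comm w q]
  ring

end Sliding

/-! ### Nearby contact points have nearby vertices. -/

section VertexGap

variable {n : ℕ} {F : SymMat n → ℝ} {v : Space n × ℝ → ℝ} {lam Lam δ : ℝ}

/-- Both sums are parabolas of opening `a + b ≤ 2 b` and differ by an affine function of slope `b
(y' - y)`, so `touching_gap` applies. Time 0 in the height difference is arbitrary, as both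
parabolas have the same slope in time. -/
lemma vertex_gap_of_le (hn : 1 ≤ n) (hlam : 0 < lam) (hlam1 : lam ≤ 1) (hLam : 1 ≤ Lam)
    (hF : StructureConditions lam Lam δ F)
    (hv : IsViscositySupersolution F v) (hc : ContinuousOn v (Metric.closedBall 0 1 ×ˢ univ))
    {a b r : ℝ} (ha : 0 < a) (hab : a ≤ b) (hr : 0 < r) (hδ : 14 * Lam / lam * (a + b) < δ)
    {y₀ y y' x x' : Space n} {s₀ s s' t t' : ℝ} (ht : t ≤ t') (htr : t' ≤ t + r ^ 2)
    (hx : ‖x' - x‖ ≤ r)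
    (hroom : ∀ τ ∈ Icc (t - (gapRadius lam Lam * r) ^ 2) t', ∀ ξ,
      ‖ξ - x‖ ≤ gapRadius lam Lam * r → (ξ, τ) ∈ Q₁ n)
    (h : TouchesBelow (fun z => concaveParabola a y₀ s₀ z + concaveParabola b y s z) v x t)
    (h' : TouchesBelow (fun z => concaveParabola a y₀ s₀ z + concaveParabola b y' s' z) v x' t') :
    ‖y' - y‖ ≤ 2 * gapSlope lam Lam * r ∧
      0 ≤ concaveParabola b y s (x, 0) - concaveParabola b y' s' (x, 0) ∧
      concaveParabola b y s (x, 0) - concaveParabola b y' s' (x, 0)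
        ≤ 16 * Lam * gapSlope lam Lam * b * r ^ 2 := by
  have hC0 : 0 < gapSlope lam Lam := by
    linarith [gapRadius_ge hlam hlam1 hLam, gapSlope_ge hlam hlam1 hLam]
  have hb : 0 < b := ha.trans_le hab
  have e1 : (fun z => concaveParabola a y₀ s₀ z + concaveParabola b y s z) = _ :=
    funext (concaveParabola_add (by positivity : a + b ≠ 0) y₀ y s₀ s)
  have e2 : (fun z => concaveParabola a y₀ s₀ z + concaveParabola b y' s' z)
      = fun z => (concaveParabola a y₀ s₀ z + concaveParabola b y s z) + (⟪b • (y' - y), z.1 - x⟫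
      - (concaveParabola b y s (x, 0) - concaveParabola b y' s' (x, 0))) := by
    funext z
    rw [concaveParabola_eq_add_affine b y y' x s s' z, add_assoc]
  simp only [concaveParabola_add (by positivity : a + b ≠ 0) y₀ y s₀ s] at e2
  rw [e1] at h
  rw [e2] at h'
  obtain ⟨g1, g2, g3⟩ := touching_gap hn hlam hlam1 hLam hF hv hc (by positivity : 0 < a + b) hr hδ
    ht htr hx hroom h h'
  refine ⟨?_, g2, g3.trans ?_⟩
  · rw [norm_smul, Real.norm_eq_abs, abs_of_pos hb] at g1
    have : b * ‖y' - y‖ ≤ b * (2 * gapSlope lam Lam * r) := by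
      refine g1.trans ?_
      have : 0 < gapSlope lam Lam * r := by positivity
      nlinarith
    exact le_of_mul_le_mul_left this hb
  · have : 0 < Lam * gapSlope lam Lam * r ^ 2 := by positivity
    nlinarith

/-- The vertices of two touching parabolas whose contact points are close lie, up to a shear, at
comparable parabolic distance. -/
lemma vertex_gap (hn : 1 ≤ n) (hlam : 0 < lam) (hlam1 : lam ≤ 1) (hLam : 1 ≤ Lam)
    (hF : StructureConditions lam Lam δ F)
    (hv : IsViscositySupersolution F v) (hc : ContinuousOn v (Metric.closedBall 0 1 ×ˢ univ))
    {a b r : ℝ} (ha : 0 < a) (hab : a ≤ b) (hr : 0 < r) (hδ : 14 * Lam / lam * (a + b) < δ)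
    {y₀ y y' x x' : Space n} {s₀ s s' t t' : ℝ} (ht0 : t ≤ 0) (ht0' : t' ≤ 0)
    (htr : |t' - t| ≤ r ^ 2) (hx : ‖x' - x‖ ≤ r)
    (hroom : ∀ τ ∈ Icc (t - 2 * (gapRadius lam Lam * r) ^ 2) 0, ∀ ξ,
      ‖ξ - x‖ ≤ 2 * (gapRadius lam Lam * r) → (ξ, τ) ∈ Q₁ n)
    (h : TouchesBelow (fun z => concaveParabola a y₀ s₀ z + concaveParabola b y s z) v x t)
    (h' : TouchesBelow (fun z => concaveParabola a y₀ s₀ z + concaveParabola b y' s' z) v x' t') :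
    ‖y' - y‖ ≤ 2 * gapSlope lam Lam * r ∧
      |concaveParabola b y' s' (x, 0) - concaveParabola b y s (x, 0)|
        ≤ 18 * Lam * gapSlope lam Lam * b * r ^ 2 := by
  have hm := gapRadius_ge hlam hlam1 hLam
  have hC0 : 0 < gapSlope lam Lam := by linarith [gapSlope_ge hlam hlam1 hLam]
  have hb : 0 < b := ha.trans_le hab
  have hpos : 0 < gapSlope lam Lam * b * r ^ 2 := by positivity
  have hposL : gapSlope lam Lam * b * r ^ 2 ≤ Lam * (gapSlope lam Lam * b * r ^ 2) :=
    le_mul_of_one_le_left hpos.le hLam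
  have hmr : r ≤ gapRadius lam Lam * r := le_mul_of_one_le_left hr.le (by linarith)
  rw [abs_le] at htr
  rcases le_total t t' with ht | ht
  · obtain ⟨g1, g2, g3⟩ := vertex_gap_of_le hn hlam hlam1 hLam hF hv hc ha hab hr hδ ht
      (by linarith) hx (fun τ hτ ξ hξ => hroom τ ⟨by nlinarith [hτ.1, sq_nonneg (gapRadius lam Lam * r)],
        hτ.2.trans ht0'⟩ ξ (by linarith)) h h'
    refine ⟨g1, ?_⟩
    rw [abs_le]
    constructor <;> linarith
  -- With the times reversed the estimate is centred at `x'`. Moving the affine function back to `x`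
  -- costs `2 C b r²`, whence 18 instead of 16, and the room must be doubled.
  · obtain ⟨g1, g2, g3⟩ := vertex_gap_of_le hn hlam hlam1 hLam hF hv hc ha hab hr hδ ht
      (by linarith) (by rwa [norm_sub_rev]) (fun τ hτ ξ hξ => hroom τ
        ⟨by nlinarith [hτ.1, pow_le_pow_left₀ hr.le hmr 2], hτ.2.trans ht0⟩ ξ (by
          have : ξ - x = (ξ - x') + (x' - x) := by abel
          rw [this]
          exact (norm_add_le _ _).trans (by linarith))) h' h
    rw [norm_sub_rev] at g1
    refine ⟨g1, ?_⟩
    have e1 := concaveParabola_eq_add_affine b y' y x' s' s (x, 0)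
    simp only at e1
    have e2 : |⟪b • (y - y'), x - x'⟫| ≤ 2 * (gapSlope lam Lam * b * r ^ 2) := by
      refine (abs_real_inner_le_norm _ _).trans ?_
      rw [norm_smul, Real.norm_eq_abs, abs_of_pos hb, norm_sub_rev y y', norm_sub_rev x x']
      calc b * ‖y' - y‖ * ‖x' - x‖ ≤ b * (2 * gapSlope lam Lam * r) * r := by gcongr
        _ = _ := by ring
    rw [abs_le] at e2 ⊢
    constructor <;> linarith

end VertexGap

/-! ### Volumes of cylinders. -/

section Measure

variable {n : ℕ}

/-- A sheared cylinder is not larger than the cylinder. -/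
lemma volume_sheared_cylinder_le (y : Space n) (R h : ℝ) {f : Space n → ℝ} (hf : Continuous f) :
    volume {e : Space n × ℝ | ‖e.1 - y‖ ≤ R ∧ |e.2 - f e.1| ≤ h}
      ≤ volume (Metric.closedBall y R) * ENNReal.ofReal (2 * h) := by
  have hm : MeasurableSet {e : Space n × ℝ | ‖e.1 - y‖ ≤ R ∧ |e.2 - f e.1| ≤ h} := by
    refine IsClosed.measurableSet (IsClosed.inter ?_ ?_)
    · exact isClosed_le (continuous_fst.sub continuous_const).norm continuous_const
    · exact isClosed_le (continuous_snd.sub (hf.comp continuous_fst)).abs continuous_const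
  rw [Measure.volume_eq_prod, Measure.prod_apply hm]
  calc ∫⁻ x, volume (Prod.mk x ⁻¹' {e : Space n × ℝ | ‖e.1 - y‖ ≤ R ∧ |e.2 - f e.1| ≤ h})
      ≤ ∫⁻ x, (Metric.closedBall y R).indicator (fun _ => ENNReal.ofReal (2 * h)) x := by
        refine lintegral_mono fun x => ?_
        by_cases hx : x ∈ Metric.closedBall y R
        · rw [indicator_of_mem hx]
          refine (measure_mono (t := Icc (f x - h) (f x + h)) ?_).trans ?_
          · intro s hs
            have := abs_le.1 hs.2
            exact ⟨by linarith [this.1], by linarith [this.2]⟩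
          · rw [Real.volume_Icc]
            exact ENNReal.ofReal_le_ofReal (by linarith)
        · rw [indicator_of_notMem hx]
          refine (measure_mono_null (t := ∅) ?_ measure_empty).le
          intro s hs
          exact hx (by rw [Metric.mem_closedBall, dist_eq_norm]; exact hs.1)
    _ = _ := by
        rw [lintegral_indicator_const Metric.isClosed_closedBall.measurableSet, mul_comm]

lemma volume_cylinder (x : Space n) {R : ℝ} (hR : 0 ≤ R) (t₁ t₂ : ℝ) :
    volume (Metric.closedBall x R ×ˢ Icc t₁ t₂) =
      ENNReal.ofReal (R ^ n) * volume (Metric.ball (0 : Space n) 1)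
        * ENNReal.ofReal (t₂ - t₁) := by
  rw [Measure.volume_eq_prod, Measure.prod_prod, Real.volume_Icc, Measure.addHaar_closedBall _ _ hR,
    finrank_euclideanSpace_fin]

lemma volume_open_cylinder (x : Space n) {R : ℝ} (hR : 0 < R) (t₁ t₂ : ℝ) :
    volume (Metric.ball x R ×ˢ Ioo t₁ t₂) =
      ENNReal.ofReal (R ^ n) * volume (Metric.ball (0 : Space n) 1)
        * ENNReal.ofReal (t₂ - t₁) := by
  rw [Measure.volume_eq_prod, Measure.prod_prod, Real.volume_Ioo,
    Measure.addHaar_ball_of_pos _ _ hR, finrank_euclideanSpace_fin]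

end Measure

/-! ### Vertices are controlled by contact points. -/

section VertexMeasure

variable {n : ℕ} {F : SymMat n → ℝ} {v : Space n × ℝ → ℝ} {lam Lam δ : ℝ}

/-- The constant in the bound for the measure of a vertex set by that of the contact set. -/
noncomputable def vertexConst (n : ℕ) (lam Lam : ℝ) : ℝ :=
  (6 * gapSlope lam Lam) ^ n * (162 * Lam * gapSlope lam Lam)

/-- Chooses a covering cylinder inside `U` that leaves room for the gap estimate at scale `3 r`, the
distance reached by the Vitali enlargement. -/
lemma exists_small_scale {M : ℝ} (hM : 1 ≤ M) {U : Set (Space n × ℝ)} (hU : IsOpen U)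
    {z : Space n × ℝ} (hzU : z ∈ U) (hzQ : z ∈ Q₁ n) :
    ∃ r, 0 < r ∧ r ≤ 1 ∧ Metric.ball z.1 r ×ˢ Ioo (z.2 - r ^ 2) (z.2 + r ^ 2) ⊆ U ∧
      ∀ τ ∈ Icc (z.2 - 2 * (M * (3 * r)) ^ 2) 0, ∀ ξ, ‖ξ - z.1‖ ≤ 2 * (M * (3 * r)) →
        (ξ, τ) ∈ Q₁ n := by
  obtain ⟨ε, hε, hεU⟩ := Metric.isOpen_iff.1 hU z hzU
  have hz1 : ‖z.1‖ < 1 := by simpa using hzQ.1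
  have hz2 : -1 < z.2 := hzQ.2.1
  have hM0 : 0 < M := by linarith
  set r := min (min 1 ε) (min ((1 - ‖z.1‖) / (12 * M)) ((1 + z.2) / (36 * M ^ 2))) with hr
  have hr0 : 0 < r := by
    refine lt_min (lt_min one_pos hε) (lt_min (div_pos (by linarith) (by positivity))
      (div_pos (by linarith) (by positivity)))
  have hr1 : r ≤ 1 := (min_le_left _ _).trans (min_le_left _ _)
  have hr2 : r ≤ ε := (min_le_left _ _).trans (min_le_right _ _)
  have hr3 : r * (12 * M) ≤ 1 - ‖z.1‖ := by
    rw [← le_div_iff₀ (by positivity)]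
    exact (min_le_right _ _).trans (min_le_left _ _)
  have hr4 : r * (36 * M ^ 2) ≤ 1 + z.2 := by
    rw [← le_div_iff₀ (by positivity)]
    exact (min_le_right _ _).trans (min_le_right _ _)
  have hrr : r ^ 2 ≤ r := by nlinarith
  refine ⟨r, hr0, hr1, ?_, ?_⟩
  · rintro ⟨ξ, τ⟩ ⟨h1, h2⟩
    refine hεU ?_
    rw [Metric.mem_ball, Prod.dist_eq]
    refine max_lt (h1.trans_le hr2) ?_
    simp only [Real.dist_eq, abs_lt]
    constructor <;> linarith [h2.1, h2.2]
  · intro τ hτ ξ hξ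
    refine ⟨?_, ?_, hτ.2⟩
    · rw [mem_ball_zero_iff]
      have : ξ = (ξ - z.1) + z.1 := by abel
      rw [this]
      refine (norm_add_le _ _).trans_lt ?_
      have : 0 < r * M := by positivity
      linarith
    · have h5 : M ^ 2 * r ^ 2 ≤ M ^ 2 * r := mul_le_mul_of_nonneg_left hrr (by positivity)
      have := hτ.1
      have h6 : 0 < r * M ^ 2 := by positivity
      nlinarith

/-- The measure of a set of vertices is controlled by the measure of the set of the contact points
of the corresponding parabolas. -/
lemma volume_vertices_le (hn : 1 ≤ n) (hlam : 0 < lam) (hlam1 : lam ≤ 1) (hLam : 1 ≤ Lam)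
    (hF : StructureConditions lam Lam δ F)
    (hv : IsViscositySupersolution F v) (hc : ContinuousOn v (Metric.closedBall 0 1 ×ˢ univ))
    {a b : ℝ} (ha : 0 < a) (hab : a ≤ b) (hδ : 14 * Lam / lam * (a + b) < δ)
    {y₀ : Space n} {s₀ : ℝ} {V Z : Set (Space n × ℝ)} (hZ : Z ⊆ Q₁ n)
    (hV : ∀ e ∈ V, ∃ z ∈ Z, TouchesBelow
      (fun w => concaveParabola a y₀ s₀ w + concaveParabola b e.1 e.2 w) v z.1 z.2) :
    volume V ≤ ENNReal.ofReal (vertexConst n lam Lam) * volume Z := by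
  have hm := gapRadius_ge hlam hlam1 hLam
  set C := gapSlope lam Lam with hC
  have hC0 : 0 < C := by linarith [gapSlope_ge hlam hlam1 hLam]
  have hb : 0 < b := ha.trans_le hab
  set κ := vertexConst n lam Lam with hκ
  refine ENNReal.le_of_forall_pos_le_add fun ε hε _ => ?_
  set ε' : ENNReal := ε / ENNReal.ofReal κ with hε'
  have hκ0 : 0 < κ := by rw [hκ, vertexConst]; positivity
  have hκ' : ENNReal.ofReal κ ≠ 0 := by simpa using hκ0
  have hε'0 : ε' ≠ 0 := (ENNReal.div_pos (by simpa using hε.ne') ENNReal.ofReal_ne_top).ne'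
  -- No measurability of `Z` is needed: the disjoint cylinders are measured inside an open set of
  -- almost the same outer measure.
  obtain ⟨U, hZU, hUo, hUm⟩ := Z.exists_isOpen_le_add volume hε'0
  suffices hmain : volume V ≤ ENNReal.ofReal κ * volume U by
    refine hmain.trans ((mul_le_mul_right hUm _).trans ?_)
    rw [mul_add, hε', ENNReal.mul_div_cancel hκ' ENNReal.ofReal_ne_top]
  set W : Set (Space n × ℝ) := {z | z ∈ Z ∧ ∃ e : Space n × ℝ, TouchesBelow
    (fun w => concaveParabola a y₀ s₀ w + concaveParabola b e.1 e.2 w) v z.1 z.2} with hW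
  have hscale : ∀ z : Space n × ℝ, ∃ r : ℝ, z ∈ W → 0 < r ∧ r ≤ 1 ∧
      Metric.ball z.1 r ×ˢ Ioo (z.2 - r ^ 2) (z.2 + r ^ 2) ⊆ U ∧
      ∀ τ ∈ Icc (z.2 - 2 * (gapRadius lam Lam * (3 * r)) ^ 2) 0, ∀ ξ,
        ‖ξ - z.1‖ ≤ 2 * (gapRadius lam Lam * (3 * r)) → (ξ, τ) ∈ Q₁ n := by
    intro z
    by_cases hz : z ∈ W
    · obtain ⟨r, hr⟩ := exists_small_scale (by linarith : 1 ≤ gapRadius lam Lam) hUo (hZU hz.1)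
        (hZ hz.1)
      exact ⟨r, fun _ => hr⟩
    · exact ⟨0, fun h => absurd h hz⟩
  choose r hr using hscale
  have hvertex : ∀ z : Space n × ℝ, ∃ e : Space n × ℝ, z ∈ W → TouchesBelow
      (fun w => concaveParabola a y₀ s₀ w + concaveParabola b e.1 e.2 w) v z.1 z.2 := by
    intro z
    by_cases hz : z ∈ W
    · exact ⟨hz.2.choose, fun _ => hz.2.choose_spec⟩
    · exact ⟨0, fun h => absurd h hz⟩
  choose e he using hvertex
  set B : Space n × ℝ → Set (Space n × ℝ) := fun z =>
    Metric.ball z.1 (r z) ×ˢ Ioo (z.2 - r z ^ 2) (z.2 + r z ^ 2) with hB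
  have hBne : ∀ z ∈ W, (B z).Nonempty := fun z hz => by
    have := (hr z hz).1
    exact ⟨z, by simpa using this, by constructor <;> nlinarith⟩
  obtain ⟨T, hTW, hTd, hTc⟩ := Vitali.exists_disjoint_subfamily_covering_enlargement B W r 2
    one_lt_two (fun z hz => (hr z hz).1.le) 1 (fun z hz => (hr z hz).2.1) hBne
  have hTcount : T.Countable := hTd.countable_of_isOpen
    (fun z _ => Metric.isOpen_ball.prod isOpen_Ioo) (fun z hz => hBne z (hTW hz))
  -- The gap estimate nearly prescribes the height of the parabola over `z.1`, which fixes the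
  -- vertex time as a quadratic function of the vertex position; hence the shear.
  set S : Space n × ℝ → Set (Space n × ℝ) := fun z =>
    {w | ‖w.1 - (e z).1‖ ≤ 2 * C * (3 * r z) ∧
      |w.2 - ((e z).2 + (‖z.1 - (e z).1‖ ^ 2 - ‖z.1 - w.1‖ ^ 2) / 2)|
        ≤ 18 * Lam * C * (3 * r z) ^ 2} with hS
  have hcover : V ⊆ ⋃ z ∈ T, S z := by
    intro w hw
    obtain ⟨z', hz'Z, hz'⟩ := hV w hw
    have hz'W : z' ∈ W := ⟨hz'Z, w, hz'⟩
    obtain ⟨z, hzT, ⟨p, hp', hp⟩, hrr⟩ := hTc z' hz'W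
    obtain ⟨hr0, hr1, -, hroom⟩ := hr z (hTW hzT)
    have hr0' := (hr z' hz'W).1
    have d1 : ‖z'.1 - z.1‖ ≤ 3 * r z := by
      rw [← dist_eq_norm]
      have h1 := hp'.1
      have h2 := hp.1
      rw [Metric.mem_ball] at h1 h2
      have := dist_triangle_left z'.1 z.1 p.1
      linarith
    have d2 : |z'.2 - z.2| ≤ (3 * r z) ^ 2 := by
      have h1 := hp'.2
      have h2 := hp.2
      have h3 : r z' ^ 2 ≤ (2 * r z) ^ 2 := pow_le_pow_left₀ hr0'.le hrr 2
      rw [abs_le]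
      constructor <;> nlinarith [h1.1, h1.2, h2.1, h2.2]
    obtain ⟨g1, g2⟩ := vertex_gap hn hlam hlam1 hLam hF hv hc ha hab (by positivity : 0 < 3 * r z)
      hδ (hZ (hTW hzT).1).2.2 (hZ hz'Z).2.2 d2 d1 hroom (he z (hTW hzT)) hz'
    refine mem_iUnion₂.2 ⟨z, hzT, g1, ?_⟩
    have g3 : concaveParabola b w.1 w.2 (z.1, 0) - concaveParabola b (e z).1 (e z).2 (z.1, 0)
        = -b * (w.2 - ((e z).2 + (‖z.1 - (e z).1‖ ^ 2 - ‖z.1 - w.1‖ ^ 2) / 2)) := by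
      simp only [concaveParabola]; ring
    rw [g3, abs_mul, abs_neg, abs_of_pos hb] at g2
    refine le_of_mul_le_mul_left (g2.trans (le_of_eq ?_)) hb
    ring
  have hSB : ∀ z ∈ T, volume (S z) ≤ ENNReal.ofReal κ * volume (B z) := by
    intro z hz
    have hr0 := (hr z (hTW hz)).1
    refine (volume_sheared_cylinder_le (e z).1 (2 * C * (3 * r z)) (18 * Lam * C * (3 * r z) ^ 2)
      (f := fun ξ => (e z).2 + (‖z.1 - (e z).1‖ ^ 2 - ‖z.1 - ξ‖ ^ 2) / 2) (by fun_prop)).trans ?_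
    rw [Measure.addHaar_closedBall _ _ (by positivity), finrank_euclideanSpace_fin, hB,
      volume_open_cylinder _ hr0]
    have e1 : ENNReal.ofReal ((2 * C * (3 * r z)) ^ n) * volume (Metric.ball (0 : Space n) 1)
        * ENNReal.ofReal (2 * (18 * Lam * C * (3 * r z) ^ 2))
        = ENNReal.ofReal ((2 * C * (3 * r z)) ^ n) *
          ENNReal.ofReal (2 * (18 * Lam * C * (3 * r z) ^ 2))
          * volume (Metric.ball (0 : Space n) 1) := by ring
    have e2 : ENNReal.ofReal κ * (ENNReal.ofReal (r z ^ n) * volume (Metric.ball (0 : Space n) 1)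
        * ENNReal.ofReal (z.2 + r z ^ 2 - (z.2 - r z ^ 2)))
        = ENNReal.ofReal κ * (ENNReal.ofReal (r z ^ n) *
          ENNReal.ofReal (z.2 + r z ^ 2 - (z.2 - r z ^ 2)))
          * volume (Metric.ball (0 : Space n) 1) := by ring
    rw [e1, e2, ← ENNReal.ofReal_mul (by positivity), ← ENNReal.ofReal_mul (by positivity),
      ← ENNReal.ofReal_mul hκ0.le]
    refine mul_le_mul_left (ENNReal.ofReal_le_ofReal (le_of_eq ?_)) _
    rw [hκ, vertexConst, ← hC]
    ring
  calc volume V ≤ volume (⋃ z ∈ T, S z) := measure_mono hcover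
    _ ≤ ∑' z : T, volume (S z) := measure_biUnion_le volume hTcount S
    _ ≤ ∑' z : T, ENNReal.ofReal κ * volume (B z) :=
        ENNReal.tsum_le_tsum fun z => hSB z z.2
    _ = ENNReal.ofReal κ * ∑' z : T, volume (B z) := ENNReal.tsum_mul_left
    _ = ENNReal.ofReal κ * volume (⋃ z ∈ T, B z) := by
        rw [measure_biUnion hTcount hTd fun z _ =>
          (Metric.isOpen_ball.prod isOpen_Ioo).measurableSet]
    _ ≤ ENNReal.ofReal κ * volume U :=
        mul_le_mul_right (measure_mono (iUnion₂_subset fun z hz => (hr z (hTW hz)).2.2.1)) _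

end VertexMeasure

/-! ### Closed contact sets: monotonicity and compactness. -/

section ContactSets

variable {n : ℕ} {v : Space n × ℝ → ℝ}

/-- The non-strict version of the contact set inside `Q₁`. -/
def closedContactSet (a : ℝ) (v : Space n × ℝ → ℝ) : Set (Space n × ℝ) :=
  {z | z ∈ Q₁ n ∧ ∃ e ∈ closedQ₁ n, TouchesBelow (concaveParabola a e.1 e.2) v z.1 z.2}

/-- The vertex of the sum of two concave parabolas that is nonnegative somewhere in `Q₁`. -/
lemma exists_vertex_add {a b : ℝ} (ha : 0 < a) (hb : 0 < b) {y y' : Space n} {s s' : ℝ}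
    (hy : ‖y‖ ≤ 1) (hs : -1 ≤ s) (hy' : ‖y'‖ ≤ 1) (hs' : -1 ≤ s') {z : Space n × ℝ}
    (hz : z ∈ Q₁ n) (h : 0 ≤ concaveParabola a y s z + concaveParabola b y' s' z) :
    ∃ e ∈ closedQ₁ n, ∀ w, concaveParabola a y s w + concaveParabola b y' s' w
      = concaveParabola (a + b) e.1 e.2 w := by
  have hab : 0 < a + b := by positivity
  refine ⟨((a + b)⁻¹ • (a • y + b • y'),
    (a * s + b * s') / (a + b) + a * b / (2 * (a + b) ^ 2) * ‖y - y'‖ ^ 2), ⟨?_, ?_, ?_⟩,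
    fun w => concaveParabola_add hab.ne' y y' s s' w⟩
  · simp only [mem_closedBall_zero_iff]
    rw [norm_smul, Real.norm_eq_abs, abs_inv, abs_of_pos hab, inv_mul_le_iff₀ hab]
    refine (norm_add_le _ _).trans ?_
    rw [norm_smul, norm_smul, Real.norm_eq_abs, Real.norm_eq_abs, abs_of_pos ha, abs_of_pos hb]
    nlinarith
  · have h1 : -1 ≤ (a * s + b * s') / (a + b) := by
      rw [le_div_iff₀ hab]; nlinarith
    have h2 : 0 ≤ a * b / (2 * (a + b) ^ 2) * ‖y - y'‖ ^ 2 := by positivity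
    simp only; linarith
  -- A concave parabola is negative before its vertex time, so nonnegativity at `z` puts that time
  -- at or below `z.2 ≤ 0`.
  · rw [concaveParabola_add hab.ne'] at h
    simp only [concaveParabola] at h ⊢
    have h1 : 0 ≤ (a + b) / 2 * ‖z.1 - (a + b)⁻¹ • (a • y + b • y')‖ ^ 2 := by positivity
    have h2 : 0 ≤ (a + b) * (z.2 - ((a * s + b * s') / (a + b)
        + a * b / (2 * (a + b) ^ 2) * ‖y - y'‖ ^ 2)) := by linarith
    have h3 := nonneg_of_mul_nonneg_right h2 hab
    linarith [hz.2.2]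

/-- Adding a parabola of opening `a' - a` with vertex at the contact point keeps the contact and
makes it strict at earlier times; `v ≥ 0` keeps the new vertex in `closedQ₁`. -/
lemma exists_steeper_contact (hv0 : ∀ z ∈ Q₁ n, 0 ≤ v z) {a a' : ℝ} (ha : 0 < a) (haa : a < a')
    {z : Space n × ℝ} (hz : z ∈ closedContactSet a v) :
    ∃ e ∈ closedQ₁ n, TouchesBelow (concaveParabola a' e.1 e.2) v z.1 z.2 ∧
      ContactsBelow (concaveParabola a' e.1 e.2) v z.1 z.2 := by
  obtain ⟨hzQ, e₀, he₀, ht⟩ := hz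
  have hb : 0 < a' - a := by linarith
  have hz0 : concaveParabola (a' - a) z.1 z.2 (z.1, z.2) = 0 := by simp [concaveParabola]
  obtain ⟨e, he, hsum⟩ := exists_vertex_add ha hb (y := e₀.1) (s := e₀.2) (y' := z.1) (s' := z.2)
    (by simpa using he₀.1) he₀.2.1 (by simpa using (mem_ball_zero_iff.1 hzQ.1).le) hzQ.2.1.le hzQ (by
      have := hv0 z hzQ
      have h2 := ht.2
      rw [show (z.1, z.2) = z from rfl] at hz0 h2
      rw [hz0, h2]; linarith)
  rw [show a + (a' - a) = a' by ring] at hsum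
  have hle : ∀ ξ, ∀ τ ≤ z.2, concaveParabola (a' - a) z.1 z.2 (ξ, τ) ≤ (a' - a) * (τ - z.2) := by
    intro ξ τ _
    simp only [concaveParabola]
    have : 0 ≤ (a' - a) / 2 * ‖ξ - z.1‖ ^ 2 := by positivity
    linarith
  refine ⟨e, he, ⟨fun ξ hξ τ hτ => ?_, ?_⟩, ⟨fun ξ hξ τ hτ => ?_, ?_⟩⟩
  · rw [← hsum]
    have := ht.1 ξ hξ τ hτ
    have := hle ξ τ hτ
    nlinarith
  · rw [← hsum, hz0, add_zero]; exact ht.2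
  · rw [← hsum]
    have := ht.1 ξ (Metric.ball_subset_closedBall hξ) τ hτ.le
    have := hle ξ τ hτ.le
    nlinarith
  · rw [← hsum, hz0, add_zero]; exact ht.2

lemma closedContactSet_mono (hv0 : ∀ z ∈ Q₁ n, 0 ≤ v z) {a a' : ℝ} (ha : 0 < a) (haa : a ≤ a') :
    closedContactSet a v ⊆ closedContactSet a' v := by
  rcases haa.eq_or_lt with rfl | haa
  · exact subset_rfl
  intro z hz
  obtain ⟨e, he, ht, -⟩ := exists_steeper_contact hv0 ha haa hz
  exact ⟨hz.1, e, he, ht⟩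

lemma isCompact_lowerPB {θ T : ℝ} {x₀ : Space n} {t₀ : ℝ} (hQ : lowerPB θ T x₀ t₀ ⊆ Q₁ n) :
    IsCompact (lowerPB θ T x₀ t₀) := by
  refine ((isCompact_closedBall (0 : Space n) 1).prod (isCompact_Icc (a := (-1 : ℝ))
    (b := 0))).of_isClosed_subset ?_ fun z hz => ?_
  · refine IsClosed.inter ?_ ?_
    · exact isClosed_le (continuous_const.mul ((continuous_fst.sub continuous_const).norm.pow 2))
        (continuous_const.sub continuous_snd)
    · exact isClosed_le (continuous_const.sub continuous_snd) continuous_const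
  · exact ⟨Metric.ball_subset_closedBall (hQ hz).1, (hQ hz).2.1.le, (hQ hz).2.2⟩

lemma continuous_concaveParabola_uncurried (a : ℝ) :
    Continuous fun p : (Space n × ℝ) × (Space n × ℝ) => concaveParabola a p.2.1 p.2.2 p.1 := by
  unfold concaveParabola
  fun_prop

/-- The pairs (contact point, vertex) form a compact set, which is then projected. Writing `τ = t -
σ` with fixed `σ ≥ 0` turns the constraint `τ ≤ t`, which moves with the contact point, into an
intersection of closed conditions. -/
lemma isCompact_inter_closedContactSet (hc : ContinuousOn v (Metric.closedBall 0 1 ×ˢ univ))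
    {K : Set (Space n × ℝ)} (hK : IsCompact K) (hKQ : K ⊆ Q₁ n) (a : ℝ) :
    IsCompact (K ∩ closedContactSet a v) := by
  have hcQ : IsCompact (closedQ₁ n) := (isCompact_closedBall _ _).prod isCompact_Icc
  set S : Set ((Space n × ℝ) × (Space n × ℝ)) := (K ×ˢ closedQ₁ n ∩
    (fun p => concaveParabola a p.2.1 p.2.2 p.1 - v p.1) ⁻¹' {0}) ∩
    ⋂ ξ ∈ Metric.closedBall (0 : Space n) 1, ⋂ σ ∈ Ici (0 : ℝ),
      {p | concaveParabola a p.2.1 p.2.2 (ξ, p.1.2 - σ) ≤ v (ξ, p.1.2 - σ)} with hS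
  have hSc : IsCompact S := by
    refine (hK.prod hcQ).of_isClosed_subset ?_ fun p hp => hp.1.1
    refine IsClosed.inter ?_ ?_
    · refine ContinuousOn.preimage_isClosed_of_isClosed ?_ (hK.prod hcQ).isClosed
        isClosed_singleton
      refine (continuous_concaveParabola_uncurried a).continuousOn.sub ?_
      refine hc.comp continuous_fst.continuousOn fun p hp => ?_
      exact ⟨Metric.ball_subset_closedBall (hKQ hp.1).1, mem_univ _⟩
    · refine isClosed_biInter fun ξ hξ => isClosed_biInter fun σ _ => isClosed_le ?_ ?_
      · exact (continuous_concaveParabola_uncurried a).comp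
          (f := fun p : (Space n × ℝ) × (Space n × ℝ) => ((ξ, p.1.2 - σ), p.2)) (by fun_prop)
      · exact hc.comp_continuous (f := fun p : (Space n × ℝ) × (Space n × ℝ) => (ξ, p.1.2 - σ))
          (by fun_prop) fun p => ⟨hξ, mem_univ _⟩
  have : K ∩ closedContactSet a v = Prod.fst '' S := by
    ext z
    constructor
    · rintro ⟨hzK, -, e, he, h1, h2⟩
      refine ⟨(z, e), ⟨⟨⟨hzK, he⟩, sub_eq_zero.2 h2⟩, ?_⟩, rfl⟩
      simp only [mem_iInter]
      intro ξ hξ σ hσ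
      exact h1 ξ hξ _ (by have : 0 ≤ σ := hσ; simp only; linarith)
    · rintro ⟨⟨z, e⟩, ⟨⟨⟨hzK, he⟩, h2⟩, h3⟩, rfl⟩
      refine ⟨hzK, hKQ hzK, e, he, fun ξ hξ τ hτ => ?_, sub_eq_zero.1 h2⟩
      simp only [mem_iInter] at h3
      have := h3 ξ hξ (z.2 - τ) (by simp only [mem_Ici]; linarith)
      simpa using this
  rw [this]
  exact hSc.image continuous_fst

end ContactSets

/-! ### First heights and middle cylinders. -/

section Geometry

variable {n : ℕ}

/-- Above a point of the parabolic ball that misses a compact set containing the vertex there is a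
first height at which the upward paraboloid meets the compact set. -/
lemma exists_first_height {θ T₀ : ℝ} {x₀ : Space n} {t₀ : ℝ} (hθ : 0 < θ) {A : Set (Space n × ℝ)}
    (hA : IsCompact A) (hA0 : (x₀, t₀) ∈ A)
    {z : Space n × ℝ} (hz : z ∈ lowerPB θ T₀ x₀ t₀) (hzA : z ∉ A) :
    ∃ r R : ℝ, 0 < r ∧ r ≤ R ∧ t₀ = z.2 + θ * R ^ 2 ∧
      (∃ x₁, (x₁, z.2 + θ * r ^ 2) ∈ A ∧ ‖x₁ - z.1‖ ≤ r) ∧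
      ∀ ξ τ, θ * ‖ξ - z.1‖ ^ 2 ≤ τ - z.2 → τ - z.2 < θ * r ^ 2 → (ξ, τ) ∉ A := by
  set S : Set (Space n × ℝ) := A ∩ {w | θ * ‖w.1 - z.1‖ ^ 2 ≤ w.2 - z.2} with hS
  have hSc : IsCompact S := hA.inter_right (isClosed_le
    (continuous_const.mul ((continuous_fst.sub continuous_const).norm.pow 2))
    (continuous_snd.sub continuous_const))
  have h0S : (x₀, t₀) ∈ S := ⟨hA0, by
    have := hz.1
    rw [norm_sub_rev] at this
    exact this⟩
  obtain ⟨m, hm, hmin⟩ := hSc.exists_isMinOn ⟨_, h0S⟩ continuous_snd.continuousOn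
  have hmin' : ∀ w ∈ S, m.2 ≤ w.2 := fun w hw => hmin hw
  have hm2 : θ * ‖m.1 - z.1‖ ^ 2 ≤ m.2 - z.2 := hm.2
  have hnn : 0 ≤ θ * ‖m.1 - z.1‖ ^ 2 := by positivity
  have hpos : 0 < m.2 - z.2 := by
    rcases (hnn.trans hm2).eq_or_lt with h | h
    · exfalso
      have h1 : ‖m.1 - z.1‖ ^ 2 = 0 := by
        have : θ * ‖m.1 - z.1‖ ^ 2 = 0 := le_antisymm (by linarith) hnn
        exact (mul_eq_zero.1 this).resolve_left hθ.ne'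
      have h2 : m.1 = z.1 := by
        rw [← sub_eq_zero, ← norm_eq_zero]; exact pow_eq_zero_iff two_ne_zero |>.1 h1
      have h3 : m = z := Prod.ext h2 (by linarith)
      exact hzA (h3 ▸ hm.1)
    · exact h
  have ht0 : m.2 ≤ t₀ := hmin' _ h0S
  have e1 : θ * Real.sqrt ((m.2 - z.2) / θ) ^ 2 = m.2 - z.2 := by
    rw [Real.sq_sqrt (div_nonneg hpos.le hθ.le)]; field_simp
  have e2 : θ * Real.sqrt ((t₀ - z.2) / θ) ^ 2 = t₀ - z.2 := by
    rw [Real.sq_sqrt (div_nonneg (by linarith) hθ.le)]; field_simp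
  refine ⟨Real.sqrt ((m.2 - z.2) / θ), Real.sqrt ((t₀ - z.2) / θ), ?_, ?_, ?_, ⟨m.1, ?_, ?_⟩, ?_⟩
  · exact Real.sqrt_pos.2 (div_pos hpos hθ)
  · exact Real.sqrt_le_sqrt (by gcongr)
  · rw [e2]; ring
  · rw [e1, add_sub_cancel]; exact hm.1
  · refine Real.le_sqrt_of_sq_le ?_
    rw [le_div_iff₀ hθ]; linarith
  · intro ξ τ h1 h2 h3
    rw [e1] at h2
    have : m.2 ≤ τ := hmin' (ξ, τ) ⟨h3, h1⟩
    linarith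

/-- The centre of the middle cylinder. -/
noncomputable def midCenter (x x₀ : Space n) (r R : ℝ) : Space n := x + (3 * r / (5 * R)) • (x₀ - x)

/-- The middle cylinder. -/
def midCylinder (θ : ℝ) (x x₀ : Space n) (t r R : ℝ) : Set (Space n × ℝ) :=
  Metric.closedBall (midCenter x x₀ r R) (r / 10) ×ˢ
    Icc (t + θ * r ^ 2 / 2) (t + 3 * (θ * r ^ 2) / 4)

lemma norm_midCenter_sub_le {x x₀ : Space n} {r R : ℝ} (hr : 0 < r) (hrR : r ≤ R)
    (hx : ‖x - x₀‖ ≤ R) :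
    ‖midCenter x x₀ r R - x‖ ≤ 3 / 5 * r ∧ ‖midCenter x x₀ r R - x₀‖ ≤ R - 3 / 5 * r := by
  have hR : 0 < R := hr.trans_le hrR
  have hk0 : 0 ≤ 3 * r / (5 * R) := by positivity
  have hk1 : 3 * r / (5 * R) ≤ 1 := by rw [div_le_one (by positivity)]; linarith
  have hkR : 3 * r / (5 * R) * R = 3 / 5 * r := by field_simp
  constructor
  · rw [midCenter, add_sub_cancel_left, norm_smul, Real.norm_eq_abs, abs_of_nonneg hk0,
      norm_sub_rev, ← hkR]
    exact mul_le_mul_of_nonneg_left hx hk0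
  · have : midCenter x x₀ r R - x₀ = (1 - 3 * r / (5 * R)) • (x - x₀) := by
      rw [midCenter]; module
    rw [this, norm_smul, Real.norm_eq_abs, abs_of_nonneg (by linarith)]
    calc (1 - 3 * r / (5 * R)) * ‖x - x₀‖ ≤ (1 - 3 * r / (5 * R)) * R :=
          mul_le_mul_of_nonneg_left hx (by linarith)
      _ = R - 3 / 5 * r := by rw [sub_mul, hkR, one_mul]

/-- The proportions fit: `(7/10)² < 1/2` keeps the cylinder in the upward paraboloid from `x`, and
`(R - r/2)² ≤ R² - 3 r² / 4` for `r ≤ R` keeps it in the downward one from `x₀`. -/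
lemma mem_midCylinder {θ : ℝ} (hθ : 0 < θ) {x x₀ : Space n} {t r R : ℝ} (hr : 0 < r) (hrR : r ≤ R)
    (hx : ‖x - x₀‖ ≤ R) {w : Space n × ℝ} (hw : w ∈ midCylinder θ x x₀ t r R) :
    ‖w.1 - x‖ ≤ 7 / 10 * r ∧ θ * ‖w.1 - x‖ ^ 2 ≤ w.2 - t ∧ w.2 - t < θ * r ^ 2 ∧
      θ * ‖w.1 - x₀‖ ^ 2 ≤ t + θ * R ^ 2 - w.2 := by
  obtain ⟨h1, h2⟩ := norm_midCenter_sub_le hr hrR hx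
  obtain ⟨hw1, hw2, hw3⟩ := hw
  rw [Metric.mem_closedBall, dist_eq_norm] at hw1
  have e1 : ‖w.1 - x‖ ≤ 7 / 10 * r := by
    have : w.1 - x = (w.1 - midCenter x x₀ r R) + (midCenter x x₀ r R - x) := by abel
    rw [this]; exact (norm_add_le _ _).trans (by linarith)
  have e2 : ‖w.1 - x₀‖ ≤ R - r / 2 := by
    have : w.1 - x₀ = (w.1 - midCenter x x₀ r R) + (midCenter x x₀ r R - x₀) := by abel
    rw [this]; exact (norm_add_le _ _).trans (by linarith)
  have e3 : ‖w.1 - x‖ ^ 2 ≤ (7 / 10 * r) ^ 2 := pow_le_pow_left₀ (norm_nonneg _) e1 2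
  have e4 : ‖w.1 - x₀‖ ^ 2 ≤ (R - r / 2) ^ 2 := pow_le_pow_left₀ (norm_nonneg _) e2 2
  have e5 : 0 < θ * r ^ 2 := by positivity
  have e6 := mul_le_mul_of_nonneg_left e3 hθ.le
  have e7 := mul_le_mul_of_nonneg_left e4 hθ.le
  have e8 : θ * r ^ 2 ≤ θ * (R * r) := mul_le_mul_of_nonneg_left (by nlinarith) hθ.le
  refine ⟨e1, by nlinarith, by linarith, by nlinarith⟩

end Geometry

/-! ### Contact points of larger opening in the middle cylinder. -/

section Growth

variable {n : ℕ} {F : SymMat n → ℝ} {v : Space n × ℝ → ℝ} {lam Lam δ : ℝ}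

/-- The factor by which the opening grows in one step. -/
noncomputable def openingFactor (lam Lam : ℝ) : ℝ := 1 + 18 * growthConst lam Lam

/-- The factor that measures how small the opening has to be compared with `δ`. -/
noncomputable def smallnessFactor (lam Lam : ℝ) : ℝ := 14 * Lam / lam * openingFactor lam Lam

/-- Since `Q₁` is a product, position can be tested on the bottom slice of the parabolic ball, its
widest one. -/
lemma mem_Q₁_of_norm_le {θ T₀ : ℝ} {x₀ : Space n} {t₀ : ℝ} (hθ : 0 < θ)
    (hQ : lowerPB θ T₀ x₀ t₀ ⊆ Q₁ n) {t R : ℝ} (htR : t₀ = t + θ * R ^ 2) (hT : t₀ - t ≤ T₀)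
    {ξ : Space n} (hξ : ‖ξ - x₀‖ ≤ R) {τ : ℝ} (hτ1 : t ≤ τ) (hτ2 : τ ≤ t₀) : (ξ, τ) ∈ Q₁ n := by
  have hR : 0 ≤ θ * R ^ 2 := by positivity
  have e1 : (ξ, t₀ - T₀) ∈ Q₁ n := hQ ⟨by
    have := mul_le_mul_of_nonneg_left (pow_le_pow_left₀ (norm_nonneg _) hξ 2) hθ.le
    simp only [sub_sub_cancel]
    linarith, by simp⟩
  have e2 : (x₀, t₀) ∈ Q₁ n := hQ ⟨by simp, by simp only [sub_self]; linarith⟩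
  refine ⟨e1.1, ?_, hτ2.trans e2.2.2⟩
  have := e1.2.1
  simp only at this
  linarith

lemma norm_sub_le_of_mem_lowerPB {θ T₀ : ℝ} {x x₀ : Space n} {t t₀ R : ℝ} (hθ : 0 < θ)
    (hR : 0 ≤ R) (hz : (x, t) ∈ lowerPB θ T₀ x₀ t₀) (htR : t₀ = t + θ * R ^ 2) :
    ‖x - x₀‖ ≤ R := by
  have := hz.1
  simp only at this
  exact le_of_sq_le_sq (le_of_mul_le_mul_left (by linarith) hθ) hR

lemma midCylinder_subset_Q₁ {θ T₀ : ℝ} {x₀ : Space n} {t₀ : ℝ} (hθ : 0 < θ)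
    (hQ : lowerPB θ T₀ x₀ t₀ ⊆ Q₁ n) {x : Space n} {t r R : ℝ}
    (hz : (x, t) ∈ lowerPB θ T₀ x₀ t₀) (hr : 0 < r) (hrR : r ≤ R) (htR : t₀ = t + θ * R ^ 2) :
    midCylinder θ x x₀ t r R ⊆ lowerPB θ T₀ x₀ t₀ ∩ Q₁ n := by
  intro w hw
  have hR : 0 < R := hr.trans_le hrR
  obtain ⟨-, k1, k2, k3⟩ := mem_midCylinder hθ hr hrR
    (norm_sub_le_of_mem_lowerPB hθ hR.le hz htR) hw
  have k4 : 0 ≤ θ * ‖w.1 - x‖ ^ 2 := by positivity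
  have hT := hz.2
  simp only at hT
  have : w ∈ lowerPB θ T₀ x₀ t₀ := ⟨by rw [htR]; exact k3, by linarith⟩
  exact ⟨this, hQ this⟩

/-- The backward growth estimate in the middle cylinder. -/
lemma exists_near_touching_mid (hn : 1 ≤ n) (hlam : 0 < lam) (hlam1 : lam ≤ 1) (hLam : 1 ≤ Lam)
    (hF : StructureConditions lam Lam δ F)
    (hv : IsViscositySupersolution F v) (hc : ContinuousOn v (Metric.closedBall 0 1 ×ˢ univ))
    {a : ℝ} (ha : 0 < a) (hδ : 13 * growthConst lam Lam * a < δ)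
    {θ T₀ : ℝ} {x₀ : Space n} {t₀ : ℝ} (hθ : 3 / 4 ≤ θ) (hθ4 : θ ≤ 4)
    (hQ : lowerPB θ T₀ x₀ t₀ ⊆ Q₁ n) {x x₁ : Space n} {t r R : ℝ}
    (hz : (x, t) ∈ lowerPB θ T₀ x₀ t₀) (hr : 0 < r) (hrR : r ≤ R) (htR : t₀ = t + θ * R ^ 2)
    (h1 : (x₁, t + θ * r ^ 2) ∈ lowerPB θ T₀ x₀ t₀) (hx1 : ‖x₁ - x‖ ≤ r) {y : Space n} {s : ℝ}
    (ht₀ : TouchesBelow (concaveParabola a y s) v x₁ (t + θ * r ^ 2)) :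
    ∃ x₂, ‖x₂ - midCenter x x₀ r R‖ ≤ r / 20 ∧ v (x₂, t + 5 * (θ * r ^ 2) / 8) ≤
      concaveParabola a y s (x₂, t + 5 * (θ * r ^ 2) / 8)
        + growthConst lam Lam * a * (r / 20) ^ 2 := by
  have hθ0 : 0 < θ := by linarith
  have hR : 0 < R := hr.trans_le hrR
  have hT : t₀ - t ≤ T₀ := hz.2
  have hxR := norm_sub_le_of_mem_lowerPB hθ0 hR.le hz htR
  have hx1R : ‖x₁ - x₀‖ < R := by
    have := h1.1
    simp only at this
    have h2 : 0 < θ * r ^ 2 := by positivity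
    exact lt_of_pow_lt_pow_left₀ 2 hR.le (lt_of_mul_lt_mul_left (by linarith) hθ0.le)
  obtain ⟨m1, m2⟩ := norm_midCenter_sub_le hr hrR hxR
  generalize midCenter x x₀ r R = c₀ at m1 m2 ⊢
  set ρ : ℝ := r / 20 with hρ
  have hρ0 : 0 < ρ := by positivity
  have hk0 : 0 < ρ / R := by positivity
  have hk1 : ρ / R ≤ 1 := by rw [div_le_one hR]; linarith
  have hkR : ρ / R * R = ρ := by field_simp
  -- The tube ends at `x₁` pushed towards `x₀` by less than `ρ`: the tube then stays within `R` of
  -- `x₀`, with `x₁` strictly inside.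
  set c₁ : Space n := x₁ + (ρ / R) • (x₀ - x₁) with hc₁
  have hc1a : ‖x₁ - c₁‖ < ρ := by
    have : x₁ - c₁ = (ρ / R) • (x₁ - x₀) := by rw [hc₁]; module
    rw [this, norm_smul, Real.norm_eq_abs, abs_of_pos hk0]
    calc ρ / R * ‖x₁ - x₀‖ < ρ / R * R := mul_lt_mul_of_pos_left hx1R hk0
      _ = ρ := hkR
  have hc1b : ‖c₁ - x₀‖ ≤ R - ρ := by
    have : c₁ - x₀ = (1 - ρ / R) • (x₁ - x₀) := by rw [hc₁]; module
    rw [this, norm_smul, Real.norm_eq_abs, abs_of_nonneg (by linarith)]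
    calc (1 - ρ / R) * ‖x₁ - x₀‖ ≤ (1 - ρ / R) * R :=
          mul_le_mul_of_nonneg_left hx1R.le (by linarith)
      _ = R - ρ := by rw [sub_mul, hkR, one_mul]
  clear_value c₁
  have hspeed : ‖c₁ - c₀‖ ≤ 33 / 20 * r := by
    have : c₁ - c₀ = (x₁ - x) - (x₁ - c₁) - (c₀ - x) := by abel
    rw [this]
    refine (norm_sub_le _ _).trans ((add_le_add_left (norm_sub_le _ _) _).trans ?_)
    linarith
  have hθr : 3 / 4 * r ^ 2 ≤ θ * r ^ 2 := mul_le_mul_of_nonneg_right hθ (by positivity)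
  have hθr4 : θ * r ^ 2 ≤ 4 * r ^ 2 := mul_le_mul_of_nonneg_right hθ4 (by positivity)
  have hr2 : 0 < r ^ 2 := by positivity
  have hrR2 : θ * r ^ 2 ≤ θ * R ^ 2 :=
    mul_le_mul_of_nonneg_left (pow_le_pow_left₀ hr.le hrR 2) hθ0.le
  -- The height is `3 θ r² / 8 ≤ 3 r² / 2 = 600 ρ²`, and the speed bound compares `33/400` with
  -- `(2/5)(3/8)(3/4)`.
  refine exists_near_touching hn hlam hlam1 hLam hF hv hc ha hρ0 hδ
    (c₁ := c₁) (t₁ := t + θ * r ^ 2) (by linarith)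
    (by have : ρ ^ 2 = r ^ 2 / 400 := by rw [hρ]; ring
        rw [this]; linarith)
    (by
      refine (mul_le_mul_of_nonneg_right hspeed hρ0.le).trans ?_
      have : 33 / 20 * r * ρ = 33 / 400 * r ^ 2 := by rw [hρ]; ring
      rw [this]; linarith) hc1a ?_ ht₀
  intro τ hτ ξ hξ
  set κ := (τ - (t + 5 * (θ * r ^ 2) / 8)) / (t + θ * r ^ 2 - (t + 5 * (θ * r ^ 2) / 8)) with hκ
  have hden : 0 < t + θ * r ^ 2 - (t + 5 * (θ * r ^ 2) / 8) := by linarith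
  have hκ0 : 0 ≤ κ := div_nonneg (by linarith [hτ.1]) hden.le
  have hκ1 : κ ≤ 1 := by rw [hκ, div_le_one hden]; linarith [hτ.2]
  clear_value κ
  refine mem_Q₁_of_norm_le hθ0 hQ htR hT ?_ (by linarith [hτ.1]) (by linarith [hτ.2])
  have e1 : ξ - x₀ = (ξ - (c₀ + κ • (c₁ - c₀))) + ((1 - κ) • (c₀ - x₀) + κ • (c₁ - x₀)) := by
    module
  rw [e1]
  refine (norm_add_le _ _).trans ?_
  have e2 : ‖(1 - κ) • (c₀ - x₀) + κ • (c₁ - x₀)‖ ≤ R - ρ := by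
    refine (norm_add_le _ _).trans ?_
    rw [norm_smul, norm_smul, Real.norm_eq_abs, Real.norm_eq_abs, abs_of_nonneg hκ0,
      abs_of_nonneg (by linarith)]
    have e3 : ‖c₀ - x₀‖ ≤ R - ρ := by rw [hρ]; linarith
    linarith [mul_le_mul_of_nonneg_left e3 (by linarith : 0 ≤ 1 - κ),
      mul_le_mul_of_nonneg_left hc1b hκ0]
  linarith

/-- Parabolas with vertices just below a point where `v` is close to a touching parabola touch
nearby. -/
lemma exists_touching_near (hc : ContinuousOn v (Metric.closedBall 0 1 ×ˢ univ)) {a b d t : ℝ}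
    (hb : 0 < b) {y₀ : Space n} {s₀ : ℝ}
    (hP : ∀ ξ ∈ Metric.closedBall (0 : Space n) 1, ∀ τ ≤ t,
      concaveParabola a y₀ s₀ (ξ, τ) ≤ v (ξ, τ))
    (hd : 0 < d) {x y : Space n} {s : ℝ} (hx : x ∈ Metric.closedBall (0 : Space n) 1)
    (hxv : v (x, t) ≤ concaveParabola a y₀ s₀ (x, t) + b / 2 * d ^ 2)
    (hy : ‖y - x‖ ≤ d) (hs1 : t - 2 * d ^ 2 ≤ s) (hs2 : s ≤ t - d ^ 2) :
    ∃ ξ τ, ‖ξ - y‖ ≤ 2 * d ∧ s ≤ τ ∧ τ ≤ t ∧ TouchesBelow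
      (fun w => concaveParabola a y₀ s₀ w + concaveParabola b y s w) v ξ τ := by
  have hd2 : 0 < d ^ 2 := by positivity
  have hyx : ‖x - y‖ ^ 2 ≤ d ^ 2 :=
    pow_le_pow_left₀ (norm_nonneg _) (by rwa [norm_sub_rev]) 2
  obtain ⟨ξ, -, τ, hτ, hE0, htouch⟩ := exists_touching hc
    (contDiff_concaveParabola a y₀ s₀).continuous (contDiff_concaveParabola b y s).continuous
    (s := s) (t := t) (by linarith) hP
    (fun ξ τ hτ => by
      simp only [concaveParabola]
      have e1 : 0 ≤ b / 2 * ‖ξ - y‖ ^ 2 := by positivity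
      nlinarith) hx (by
      refine hxv.trans (add_le_add_right ?_ _)
      simp only [concaveParabola]
      have e1 : b / 2 * ‖x - y‖ ^ 2 ≤ b / 2 * d ^ 2 :=
        mul_le_mul_of_nonneg_left hyx (by positivity)
      have e2 : b * d ^ 2 ≤ b * (t - s) := mul_le_mul_of_nonneg_left (by linarith) hb.le
      linarith)
  refine ⟨ξ, τ, ?_, hτ.1, hτ.2, htouch⟩
  -- Nonnegativity of the added parabola at the contact point gives `‖ξ - y‖² ≤ 2 (τ - s) ≤ 4 d²`.
  simp only [concaveParabola] at hE0
  have e1 : b * ‖ξ - y‖ ^ 2 ≤ b * (2 * d) ^ 2 := by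
    have := mul_le_mul_of_nonneg_left hτ.2 hb.le
    have := mul_le_mul_of_nonneg_left hs1 hb.le
    linarith
  exact le_of_sq_le_sq (le_of_mul_le_mul_left e1 hb) (by positivity)

/-- The contact set with the larger opening fills a fixed part of the middle cylinder. -/
lemma volume_midCylinder_contact (hn : 1 ≤ n) (hlam : 0 < lam) (hlam1 : lam ≤ 1) (hLam : 1 ≤ Lam)
    (hF : StructureConditions lam Lam δ F)
    (hv : IsViscositySupersolution F v) (hc : ContinuousOn v (Metric.closedBall 0 1 ×ˢ univ))
    (hv0 : ∀ z ∈ Q₁ n, 0 ≤ v z) {a : ℝ} (ha : 0 < a) (hδ : smallnessFactor lam Lam * a < δ)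
    {θ T₀ : ℝ} {x₀ : Space n} {t₀ : ℝ} (hθ : 3 / 4 ≤ θ) (hθ4 : θ ≤ 4)
    (hQ : lowerPB θ T₀ x₀ t₀ ⊆ Q₁ n) {x x₁ : Space n} {t r R : ℝ}
    (hz : (x, t) ∈ lowerPB θ T₀ x₀ t₀) (hr : 0 < r) (hrR : r ≤ R) (htR : t₀ = t + θ * R ^ 2)
    (h1 : (x₁, t + θ * r ^ 2) ∈ lowerPB θ T₀ x₀ t₀ ∩ closedContactSet a v)
    (hx1 : ‖x₁ - x‖ ≤ r) :
    ENNReal.ofReal ((r / 60) ^ n) * volume (Metric.ball (0 : Space n) 1)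
        * ENNReal.ofReal ((r / 60) ^ 2) ≤ ENNReal.ofReal (vertexConst n lam Lam) *
      volume (midCylinder θ x x₀ t r R ∩ closedContactSet (openingFactor lam Lam * a) v) := by
  have hθ0 : 0 < θ := by linarith
  set G := growthConst lam Lam with hG
  have hG1 : 1 ≤ G := one_le_growthConst hlam hlam1 hLam
  have hL1 : 1 ≤ Lam / lam := by rw [le_div_iff₀ hlam]; linarith
  obtain ⟨-, e₀, he₀, ht₀⟩ := h1.2
  simp only at ht₀
  have hb13 : 13 * G * a < δ := by
    refine lt_of_le_of_lt ?_ hδ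
    rw [smallnessFactor, openingFactor, ← hG]
    have e3 : 14 * Lam / lam = 14 * (Lam / lam) := by ring
    rw [e3]
    have : 13 * G ≤ 14 * (Lam / lam) * (1 + 18 * G) := by nlinarith
    exact mul_le_mul_of_nonneg_right this ha.le
  obtain ⟨x₂, hx2, hx2v⟩ := exists_near_touching_mid hn hlam hlam1 hLam hF hv hc ha hb13 hθ hθ4
    hQ hz hr hrR htR h1.1 hx1 ht₀
  have hθr : 3 / 4 * r ^ 2 ≤ θ * r ^ 2 := mul_le_mul_of_nonneg_right hθ (by positivity)
  have hr2 : 0 < r ^ 2 := by positivity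
  set t' : ℝ := t + 5 * (θ * r ^ 2) / 8 with ht'
  set d : ℝ := r / 60 with hd
  have hd0 : 0 < d := by positivity
  have hrd : r = 60 * d := by rw [hd]; ring
  have hrd2 : r ^ 2 = 3600 * d ^ 2 := by rw [hrd]; ring
  -- Chosen so that `b / 2 * d²` equals the excess `G a (r/20)²` at `x₂`, as `r / 20 = 3 d`.
  set b : ℝ := 18 * G * a with hb
  have hb0 : 0 < b := by positivity
  have hKa : openingFactor lam Lam * a = a + b := by rw [openingFactor, ← hG, hb]; ring
  have hmidQ : midCylinder θ x x₀ t r R ⊆ Q₁ n :=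
    (midCylinder_subset_Q₁ hθ0 hQ hz hr hrR htR).trans inter_subset_right
  -- The radius `6 d = r / 10` is `3 d` from the centre to `x₂`, `d` to the vertex, `2 d` to the
  -- contact point.
  have hmem : ∀ ξ : Space n, ∀ τ, ‖ξ - midCenter x x₀ r R‖ ≤ 6 * d → t' - 2 * d ^ 2 ≤ τ → τ ≤ t' →
      (ξ, τ) ∈ midCylinder θ x x₀ t r R := by
    intro ξ τ hξ hτ1 hτ2
    refine ⟨?_, ?_, ?_⟩
    · rw [Metric.mem_closedBall, dist_eq_norm]; linarith
    · simp only; linarith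
    · simp only; linarith
  have hd2 : 0 < d ^ 2 := by positivity
  have hx2Q : x₂ ∈ Metric.closedBall (0 : Space n) 1 :=
    mem_closedBall_of_mem_Q₁ (hmidQ (hmem x₂ t' (by linarith) (by linarith) le_rfl))
  have hvol := volume_vertices_le hn hlam hlam1 hLam hF hv hc ha
    (b := b) (by rw [hb]; nlinarith) (by rw [← hKa, ← mul_assoc]; exact hδ)
    (y₀ := e₀.1) (s₀ := e₀.2)
    (V := Metric.closedBall x₂ d ×ˢ Icc (t' - 2 * d ^ 2) (t' - d ^ 2))
    (Z := midCylinder θ x x₀ t r R ∩ closedContactSet (openingFactor lam Lam * a) v)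
    (inter_subset_left.trans hmidQ) ?_
  · rw [volume_cylinder _ hd0.le] at hvol
    have e1 : t' - d ^ 2 - (t' - 2 * d ^ 2) = d ^ 2 := by ring
    rwa [e1] at hvol
  rintro ⟨y, s⟩ ⟨hy, hs1, hs2⟩
  rw [Metric.mem_closedBall, dist_eq_norm] at hy
  simp only at hy hs1 hs2
  obtain ⟨ξ, τ, hξy, hsτ, hτt, htouch⟩ := exists_touching_near hc hb0
    (fun ξ hξ τ hτ => ht₀.1 ξ hξ τ (hτ.trans (by linarith))) hd0 hx2Q
    (hx2v.trans (le_of_eq (by rw [hb, hrd]; ring))) hy hs1 hs2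
  have hyc : ‖y - midCenter x x₀ r R‖ ≤ 4 * d := by
    have e1 : y - midCenter x x₀ r R = (y - x₂) + (x₂ - midCenter x x₀ r R) := by abel
    rw [e1]
    refine (norm_add_le _ _).trans ?_
    linarith
  have hmid : (ξ, τ) ∈ midCylinder θ x x₀ t r R := by
    refine hmem ξ τ ?_ (hs1.trans hsτ) hτt
    have e1 : ξ - midCenter x x₀ r R = (ξ - y) + (y - midCenter x x₀ r R) := by abel
    rw [e1]
    refine (norm_add_le _ _).trans ?_
    linarith
  refine ⟨(ξ, τ), ⟨hmid, hmidQ hmid, ?_⟩, htouch⟩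
  have hyQ := hmidQ (hmem y s (by linarith) hs1 (by linarith))
  obtain ⟨e, he, hsum⟩ := exists_vertex_add ha hb0 (y := e₀.1) (s := e₀.2) (y' := y) (s' := s)
    (by simpa using he₀.1) he₀.2.1 (mem_ball_zero_iff.1 hyQ.1).le hyQ.2.1.le (hmidQ hmid) (by
      have e1 := htouch.2
      simp only at e1
      rw [e1]
      exact hv0 _ (hmidQ hmid))
  refine ⟨e, he, ?_⟩
  rw [hKa, ← funext hsum]
  exact htouch

end Growth

/-! ### Covering, one decay step, iteration. -/

section Decay

variable {n : ℕ} {F : SymMat n → ℝ} {v : Space n × ℝ → ℝ} {lam Lam δ : ℝ}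

/-- The constant in the covering argument. -/
noncomputable def coverConst (n : ℕ) (lam Lam : ℝ) : ℝ :=
  180 ^ n * 108000 * vertexConst n lam Lam

lemma vertexConst_pos (hlam : 0 < lam) (hlam1 : lam ≤ 1) (hLam : 1 ≤ Lam) :
    0 < vertexConst n lam Lam := by
  have : 0 < gapSlope lam Lam := by
    linarith [gapRadius_ge hlam hlam1 hLam, gapSlope_ge hlam hlam1 hLam]
  unfold vertexConst
  positivity

lemma one_le_openingFactor (hlam : 0 < lam) (hlam1 : lam ≤ 1) (hLam : 1 ≤ Lam) :
    1 ≤ openingFactor lam Lam := by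
  have := one_le_growthConst hlam hlam1 hLam
  unfold openingFactor
  linarith

/-- The part of the parabolic ball outside a contact set is controlled by the part of it that the
contact set with the larger opening fills. -/
lemma volume_diff_le (hn : 1 ≤ n) (hlam : 0 < lam) (hlam1 : lam ≤ 1) (hLam : 1 ≤ Lam)
    (hF : StructureConditions lam Lam δ F)
    (hv : IsViscositySupersolution F v) (hc : ContinuousOn v (Metric.closedBall 0 1 ×ˢ univ))
    (hv0 : ∀ z ∈ Q₁ n, 0 ≤ v z) {a : ℝ} (ha : 0 < a) (hδ : smallnessFactor lam Lam * a < δ)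
    {θ T₀ : ℝ} {x₀ : Space n} {t₀ : ℝ} (hθ : 3 / 4 ≤ θ) (hθ4 : θ ≤ 4) (hT₀ : 0 < T₀)
    (hQ : lowerPB θ T₀ x₀ t₀ ⊆ Q₁ n) (h0 : (x₀, t₀) ∈ closedContactSet a v) :
    volume (lowerPB θ T₀ x₀ t₀ \ closedContactSet a v) ≤
      ENNReal.ofReal (coverConst n lam Lam) * volume ((lowerPB θ T₀ x₀ t₀ \ closedContactSet a v) ∩
        closedContactSet (openingFactor lam Lam * a) v) := by
  have hθ0 : 0 < θ := by linarith
  set P := lowerPB θ T₀ x₀ t₀ with hP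
  set A := closedContactSet a v with hA
  set A' := closedContactSet (openingFactor lam Lam * a) v with hA'
  have hPc : IsCompact P := isCompact_lowerPB hQ
  have hPA : IsCompact (P ∩ A) := isCompact_inter_closedContactSet hc hPc hQ a
  have hPA' : IsCompact (P ∩ A') := isCompact_inter_closedContactSet hc hPc hQ _
  have h0P : (x₀, t₀) ∈ P := ⟨by simp, by simpa using hT₀.le⟩
  have hdata : ∀ z : Space n × ℝ, ∃ rR : ℝ × ℝ, z ∈ P \ A → 0 < rR.1 ∧ rR.1 ≤ rR.2 ∧
      t₀ = z.2 + θ * rR.2 ^ 2 ∧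
      (∃ x₁, (x₁, z.2 + θ * rR.1 ^ 2) ∈ P ∩ A ∧ ‖x₁ - z.1‖ ≤ rR.1) ∧
      ∀ ξ τ, θ * ‖ξ - z.1‖ ^ 2 ≤ τ - z.2 → τ - z.2 < θ * rR.1 ^ 2 → (ξ, τ) ∉ P ∩ A := by
    intro z
    by_cases hz : z ∈ P \ A
    · obtain ⟨r, R, h⟩ := exists_first_height hθ0 hPA ⟨h0P, h0⟩ hz.1 fun h => hz.2 h.2
      exact ⟨(r, R), fun _ => h⟩
    · exact ⟨0, fun h => absurd h hz⟩
  choose rR hrR using hdata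
  set r : Space n × ℝ → ℝ := fun z => (rR z).1 with hr
  set B : Space n × ℝ → Set (Space n × ℝ) := fun z =>
    midCylinder θ z.1 x₀ z.2 (rR z).1 (rR z).2 with hB
  have hxR : ∀ z ∈ P \ A, ‖z.1 - x₀‖ ≤ (rR z).2 := fun z hz =>
    norm_sub_le_of_mem_lowerPB hθ0 ((hrR z hz).1.le.trans (hrR z hz).2.1) hz.1 (hrR z hz).2.2.1
  have hBP : ∀ z ∈ P \ A, B z ⊆ P \ A := by
    intro z hz w hw
    obtain ⟨h1, h2, h3, -, h5⟩ := hrR z hz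
    have hwP := (midCylinder_subset_Q₁ hθ0 hQ hz.1 h1 h2 h3 hw).1
    obtain ⟨-, k2, k3, -⟩ := mem_midCylinder hθ0 h1 h2 (hxR z hz) hw
    exact ⟨hwP, fun hwA => h5 w.1 w.2 k2 k3 ⟨hwP, hwA⟩⟩
  have hBc : ∀ z, IsClosed (B z) := fun z => Metric.isClosed_closedBall.prod isClosed_Icc
  have hBint : ∀ z ∈ P \ A, (interior (B z)).Nonempty := by
    intro z hz
    have h1 := (hrR z hz).1
    have h2 : 0 < θ * (rR z).1 ^ 2 := by positivity
    refine ⟨(midCenter z.1 x₀ (rR z).1 (rR z).2, z.2 + 5 * (θ * (rR z).1 ^ 2) / 8), ?_⟩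
    rw [hB]
    simp only [midCylinder, interior_prod_eq, interior_Icc]
    refine ⟨Metric.ball_subset_interior_closedBall (Metric.mem_ball_self (by positivity)), ?_, ?_⟩
    · simp only; linarith
    · simp only; linarith
  have hrbound : ∀ z ∈ P \ A, r z ≤ T₀ / θ + 1 := by
    intro z hz
    obtain ⟨h1, h2, h3, -, -⟩ := hrR z hz
    have h4 := hz.1.2
    have h5 : (rR z).2 ^ 2 ≤ T₀ / θ := by
      rw [le_div_iff₀ hθ0]; linarith
    have h6 : (rR z).1 ^ 2 ≤ (rR z).2 ^ 2 := pow_le_pow_left₀ h1.le h2 2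
    have h7 : r z = (rR z).1 := rfl
    nlinarith [sq_nonneg ((rR z).1 - 1)]
  obtain ⟨T, hTD, hTd, hTc⟩ := Vitali.exists_disjoint_subfamily_covering_enlargement B (P \ A) r 2
    one_lt_two (fun z hz => (hrR z hz).1.le) (T₀ / θ + 1) hrbound
    (fun z hz => (hBint z hz).mono interior_subset)
  have hTcount : T.Countable :=
    hTd.countable_of_nonempty_interior fun z hz => hBint z (hTD hz)
  -- If two middle cylinders meet and `r w ≤ 2 r z`, the base points are at distance at most
  -- `(7/10)(2 + 1) r z`, and with `θ ≤ 4` the times differ by at most `(3/4) * 16 (r z)²`.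
  set S : Space n × ℝ → Set (Space n × ℝ) := fun z =>
    Metric.closedBall z.1 (3 * r z) ×ˢ Icc (z.2 - 15 * r z ^ 2) (z.2 + 15 * r z ^ 2) with hS
  have hcover : P \ A ⊆ ⋃ z ∈ T, S z := by
    intro w hw
    obtain ⟨z, hzT, ⟨p, hpw, hpz⟩, hrr⟩ := hTc w hw
    have hz := hTD hzT
    obtain ⟨a1, a2, a3, -⟩ := mem_midCylinder hθ0 (hrR w hw).1 (hrR w hw).2.1 (hxR w hw) hpw
    obtain ⟨b1, b2, b3, -⟩ := mem_midCylinder hθ0 (hrR z hz).1 (hrR z hz).2.1 (hxR z hz) hpz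
    have hw0 := (hrR w hw).1
    have hz0 := (hrR z hz).1
    change (rR w).1 ≤ 2 * (rR z).1 at hrr
    have a4 : 0 ≤ θ * ‖p.1 - w.1‖ ^ 2 := by positivity
    have b4 : 0 ≤ θ * ‖p.1 - z.1‖ ^ 2 := by positivity
    have c1 : (rR w).1 ^ 2 ≤ 4 * (rR z).1 ^ 2 := by
      have := pow_le_pow_left₀ hw0.le hrr 2
      nlinarith
    have c2 : θ * (rR w).1 ^ 2 ≤ 4 * (3 / 4 * (5 * (rR z).1 ^ 2)) + (rR z).1 ^ 2 := by
      have := mul_le_mul_of_nonneg_right hθ4 (sq_nonneg (rR w).1)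
      linarith
    have c3 : θ * (rR z).1 ^ 2 ≤ 4 * (rR z).1 ^ 2 :=
      mul_le_mul_of_nonneg_right hθ4 (sq_nonneg (rR z).1)
    refine mem_iUnion₂.2 ⟨z, hzT, ?_, ?_, ?_⟩
    · rw [Metric.mem_closedBall, dist_eq_norm]
      have : w.1 - z.1 = (p.1 - z.1) - (p.1 - w.1) := by abel
      rw [this]
      refine (norm_sub_le _ _).trans ?_
      simp only [hr]
      linarith
    · simp only [hr]; linarith [hpw.2.2, hpz.2.1]
    · simp only [hr]; linarith
  have hN := vertexConst_pos (n := n) hlam hlam1 hLam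
  have hSB : ∀ z ∈ T, volume (S z) ≤
      ENNReal.ofReal (coverConst n lam Lam) * volume (B z ∩ A') := by
    intro z hzT
    have hz := hTD hzT
    obtain ⟨h1, h2, h3, ⟨x₁, h4, h4'⟩, -⟩ := hrR z hz
    have key := volume_midCylinder_contact hn hlam hlam1 hLam hF hv hc hv0 ha hδ hθ hθ4 hQ
      (x := z.1) (t := z.2) hz.1 h1 h2 h3 h4 h4'
    change _ ≤ _ * volume (B z ∩ A') at key
    have h5 : 0 ≤ r z := h1.le
    calc volume (S z) = ENNReal.ofReal ((3 * r z) ^ n) * volume (Metric.ball (0 : Space n) 1)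
          * ENNReal.ofReal (z.2 + 15 * r z ^ 2 - (z.2 - 15 * r z ^ 2)) :=
          volume_cylinder _ (by positivity) _ _
      _ = ENNReal.ofReal (180 ^ n * 108000) * (ENNReal.ofReal ((r z / 60) ^ n) *
          volume (Metric.ball (0 : Space n) 1) * ENNReal.ofReal ((r z / 60) ^ 2)) := by
          have e1 : (3 * r z) ^ n = 180 ^ n * (r z / 60) ^ n := by
            rw [← mul_pow]; congr 1; ring
          have e2 : z.2 + 15 * r z ^ 2 - (z.2 - 15 * r z ^ 2) = 108000 * (r z / 60) ^ 2 := by ring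
          rw [e1, e2, ENNReal.ofReal_mul (by positivity), ENNReal.ofReal_mul (by positivity),
            ENNReal.ofReal_mul (by positivity)]
          ring
      _ ≤ ENNReal.ofReal (180 ^ n * 108000) *
          (ENNReal.ofReal (vertexConst n lam Lam) * volume (B z ∩ A')) :=
          mul_le_mul_right key _
      _ = _ := by
          rw [← mul_assoc, ← ENNReal.ofReal_mul (by positivity), coverConst]
  have hBA : ∀ z ∈ T, B z ∩ A' = B z ∩ (P ∩ A') := fun z hz => by
    rw [← inter_assoc, inter_eq_left.2 ((hBP z (hTD hz)).trans sdiff_subset)]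
  calc volume (P \ A) ≤ volume (⋃ z ∈ T, S z) := measure_mono hcover
    _ ≤ ∑' z : T, volume (S z) := measure_biUnion_le volume hTcount S
    _ ≤ ∑' z : T, ENNReal.ofReal (coverConst n lam Lam) * volume (B z ∩ A') :=
        ENNReal.tsum_le_tsum fun z => hSB z z.2
    _ = ENNReal.ofReal (coverConst n lam Lam) * ∑' z : T, volume (B z ∩ A') :=
        ENNReal.tsum_mul_left
    _ = ENNReal.ofReal (coverConst n lam Lam) * volume (⋃ z ∈ T, B z ∩ A') := by
        rw [measure_biUnion hTcount]
        · exact hTd.mono fun z => inter_subset_left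
        · intro z hz
          rw [hBA z hz]
          exact (hBc z).measurableSet.inter hPA'.isClosed.measurableSet
    _ ≤ _ := by
        refine mul_le_mul_right (measure_mono (iUnion₂_subset fun z hz => ?_)) _
        exact inter_subset_inter_left _ (hBP z (hTD hz))

/-- The fraction gained in one step. -/
noncomputable def gain (n : ℕ) (lam Lam : ℝ) : ℝ := 1 / (1 + coverConst n lam Lam)

lemma gain_mem (hlam : 0 < lam) (hlam1 : lam ≤ 1) (hLam : 1 ≤ Lam) :
    0 < gain n lam Lam ∧ gain n lam Lam < 1 := by
  have h := vertexConst_pos (n := n) hlam hlam1 hLam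
  have h2 : 0 < coverConst n lam Lam := by unfold coverConst; positivity
  unfold gain
  refine ⟨by positivity, ?_⟩
  rw [div_lt_one (by positivity)]
  linarith

/-- One step of the decay. -/
lemma volume_diff_step (hn : 1 ≤ n) (hlam : 0 < lam) (hlam1 : lam ≤ 1) (hLam : 1 ≤ Lam)
    (hF : StructureConditions lam Lam δ F)
    (hv : IsViscositySupersolution F v) (hc : ContinuousOn v (Metric.closedBall 0 1 ×ˢ univ))
    (hv0 : ∀ z ∈ Q₁ n, 0 ≤ v z) {a : ℝ} (ha : 0 < a) (hδ : smallnessFactor lam Lam * a < δ)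
    {θ T₀ : ℝ} {x₀ : Space n} {t₀ : ℝ} (hθ : 3 / 4 ≤ θ) (hθ4 : θ ≤ 4) (hT₀ : 0 < T₀)
    (hQ : lowerPB θ T₀ x₀ t₀ ⊆ Q₁ n) (h0 : (x₀, t₀) ∈ closedContactSet a v) :
    volume (lowerPB θ T₀ x₀ t₀ \ closedContactSet (openingFactor lam Lam * a) v) ≤
      ENNReal.ofReal (1 - gain n lam Lam) *
        volume (lowerPB θ T₀ x₀ t₀ \ closedContactSet a v) := by
  have hle := volume_diff_le hn hlam hlam1 hLam hF hv hc hv0 ha hδ hθ hθ4 hT₀ hQ h0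
  set P := lowerPB θ T₀ x₀ t₀ with hP
  set A := closedContactSet a v with hA
  set A' := closedContactSet (openingFactor lam Lam * a) v with hA'
  have hPc : IsCompact P := isCompact_lowerPB hQ
  have hAA' : A ⊆ A' := closedContactSet_mono hv0 ha
    (le_mul_of_one_le_left ha.le (one_le_openingFactor hlam hlam1 hLam))
  have hmeas : MeasurableSet (P ∩ A') :=
    (isCompact_inter_closedContactSet hc hPc hQ _).isClosed.measurableSet
  have hN : 0 < coverConst n lam Lam := by
    have := vertexConst_pos (n := n) hlam hlam1 hLam
    unfold coverConst; positivity
  have hg := gain_mem (n := n) hlam hlam1 hLam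
  have e1 : (P \ A) ∩ (P ∩ A') = (P \ A) ∩ A' := by
    rw [← inter_assoc, inter_eq_left.2 sdiff_subset]
  have e2 : (P \ A) \ (P ∩ A') = P \ A' := by
    ext z
    simp only [Set.mem_sdiff, mem_inter_iff, not_and]
    exact ⟨fun h => ⟨h.1.1, h.2 h.1.1⟩, fun h => ⟨⟨h.1, fun h' => h.2 (hAA' h')⟩, fun _ => h.2⟩⟩
  have hsum := measure_inter_add_sdiff (μ := volume) (P \ A) hmeas
  rw [e1, e2] at hsum
  have hfin : volume (P \ A) ≠ ⊤ :=
    ((measure_mono sdiff_subset).trans_lt hPc.measure_lt_top).ne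
  have hfx : volume ((P \ A) ∩ A') ≠ ⊤ :=
    ((measure_mono inter_subset_left).trans_lt hfin.lt_top).ne
  have hfy : volume (P \ A') ≠ ⊤ := by
    intro h; rw [h, add_top] at hsum; exact hfin hsum.symm
  generalize volume ((P \ A) ∩ A') = x at *
  generalize volume (P \ A') = y at *
  generalize volume (P \ A) = d at *
  lift x to NNReal using hfx
  lift y to NNReal using hfy
  lift d to NNReal using hfin
  have h1 : (x : ℝ) + y = d := by exact_mod_cast hsum
  have h2 : (d : ℝ) ≤ coverConst n lam Lam * x := by
    have := ENNReal.toReal_mono (ENNReal.mul_ne_top ENNReal.ofReal_ne_top ENNReal.coe_ne_top) hle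
    rwa [ENNReal.toReal_mul, ENNReal.toReal_ofReal hN.le] at this
  have h3 : (y : ℝ) ≤ (1 - gain n lam Lam) * d := by
    -- From `d ≤ N x ≤ (1 + N) x` with `N = coverConst`; the added 1 keeps the gain below 1.
    have h4 : gain n lam Lam * d ≤ x := by
      rw [gain, one_div, inv_mul_le_iff₀ (by positivity)]
      have : (0 : ℝ) ≤ x := x.2
      linarith
    linarith
  rw [← ENNReal.ofReal_coe_nnreal, ← ENNReal.ofReal_coe_nnreal (p := d),
    ← ENNReal.ofReal_mul (by linarith)]
  exact ENNReal.ofReal_le_ofReal h3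

/-- The decay for the closed contact sets. -/
lemma volume_diff_iterate (hn : 1 ≤ n) (hlam : 0 < lam) (hlam1 : lam ≤ 1) (hLam : 1 ≤ Lam)
    (hF : StructureConditions lam Lam δ F)
    (hv : IsViscositySupersolution F v) (hc : ContinuousOn v (Metric.closedBall 0 1 ×ˢ univ))
    (hv0 : ∀ z ∈ Q₁ n, 0 ≤ v z) {a : ℝ} (ha : 0 < a)
    {θ T₀ : ℝ} {x₀ : Space n} {t₀ : ℝ} (hθ : 3 / 4 ≤ θ) (hθ4 : θ ≤ 4) (hT₀ : 0 < T₀)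
    (hQ : lowerPB θ T₀ x₀ t₀ ⊆ Q₁ n) (h0 : (x₀, t₀) ∈ closedContactSet a v) (k : ℕ)
    (hδ : ∀ j < k, smallnessFactor lam Lam * (openingFactor lam Lam ^ j * a) < δ) :
    volume (lowerPB θ T₀ x₀ t₀ \ closedContactSet (openingFactor lam Lam ^ k * a) v) ≤
      ENNReal.ofReal ((1 - gain n lam Lam) ^ k) * volume (lowerPB θ T₀ x₀ t₀) := by
  have hK := one_le_openingFactor hlam hlam1 hLam
  have hg := gain_mem (n := n) hlam hlam1 hLam
  induction k with
  | zero => simpa using measure_mono sdiff_subset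
  | succ k ih =>
    have hak : 0 < openingFactor lam Lam ^ k * a := by positivity
    have hmono : a ≤ openingFactor lam Lam ^ k * a :=
      le_mul_of_one_le_left ha.le (one_le_pow₀ hK)
    have := volume_diff_step hn hlam hlam1 hLam hF hv hc hv0 hak (hδ k k.lt_succ_self) hθ hθ4 hT₀ hQ
      (closedContactSet_mono hv0 ha hmono h0)
    rw [pow_succ' (openingFactor lam Lam), mul_assoc]
    refine this.trans ((mul_le_mul_right (ih fun j hj => hδ j (hj.trans k.lt_succ_self)) _).trans
      (le_of_eq ?_))
    rw [← mul_assoc, ← ENNReal.ofReal_mul (by linarith), pow_succ']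

lemma c₀_le_one (hlam : 0 < lam) (hlam1 : lam ≤ 1) (hLam : 1 ≤ Lam) : c₀ n lam Lam ≤ 1 := by
  unfold c₀
  refine mul_le_one₀ ?_ (Real.exp_nonneg _) (Real.exp_le_one_iff.2 ?_)
  · rw [div_le_one (by positivity)]
    have h1 : lam ^ 2 ≤ 1 := pow_le_one₀ hlam.le hlam1
    have h2 : 1 ≤ Lam ^ 2 := one_le_pow₀ hLam
    have h3 : (1 : ℝ) ≤ n + 5 := by linarith [(Nat.cast_nonneg n : (0 : ℝ) ≤ n)]
    nlinarith
  · have : 0 ≤ 10 ^ 3 * Lam * n / lam := by positivity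
    linarith

lemma η₂_mem (n : ℕ) : 0 < η₂ n ∧ η₂ n ≤ 1 := by
  have h1 : (1 : ℝ) ≤ √2 + 1 := by linarith [Real.sqrt_nonneg 2]
  have hn : (0 : ℝ) ≤ n := Nat.cast_nonneg n
  unfold η₂
  refine ⟨by positivity, mul_le_one₀ ?_ (by positivity) ?_⟩
  · exact Real.rpow_le_one_of_one_le_of_nonpos (by norm_num) (by linarith)
  · exact Real.rpow_le_one_of_one_le_of_nonpos h1 (by linarith)

end Decay

end ParabolicContact

/-! ### The proposition: choice of `c₁` and return to strict contact. -/

theorem proposition3p6 (n : ℕ) (hn : 1 ≤ n) (lam Lam : ℝ)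
    (hlam : 0 < lam) (hlam1 : lam ≤ 1) (hLam : 1 ≤ Lam) :
    ∃ c₁ : ℝ, 0 < c₁ ∧ c₁ < 1 ∧
      ∀ (δ : ℝ), 0 < δ →
      ∀ (F : SymMat n → ℝ), StructureConditions lam Lam δ F →
      ∀ (u : Space n × ℝ → ℝ),
        ContinuousOn u (Metric.closedBall 0 1 ×ˢ univ) →
        (∃ B : ℝ, ∀ z ∈ (Metric.closedBall 0 1 ×ˢ univ : Set (Space n × ℝ)), |u z| ≤ B) →
        LocallyUniformlySemiconcave u →
        IsViscositySupersolution F u →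
      ∀ (θ T₀ : ℝ) (x₀ : Space n) (t₀ : ℝ), 3 / 4 ≤ θ → θ ≤ 4 → 0 < T₀ →
        lowerPB θ T₀ x₀ t₀ ⊆ Q₁ n →
      ∀ (a : ℝ), 0 < a → a < c₀ n lam Lam * δ →
        (x₀, t₀) ∈ contactSet a (closedQ₁ n) u →
      ∀ (k : ℕ), (c₁⁻¹) ^ k * a ≤ c₀ n lam Lam * δ →
        volume (lowerPB θ T₀ x₀ t₀ \ contactSet ((c₁⁻¹) ^ k * a) (closedQ₁ n) u) ≤
          ENNReal.ofReal ((1 - η₂ n * c₁) ^ k) * volume (lowerPB θ T₀ x₀ t₀) := by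
  have hK := one_le_openingFactor hlam hlam1 hLam
  obtain ⟨hg0, hg1⟩ := gain_mem (n := n) hlam hlam1 hLam
  obtain ⟨hη0, hη1⟩ := η₂_mem n
  set K := openingFactor lam Lam with hKdef
  set L := smallnessFactor lam Lam with hLdef
  have hL : 1 ≤ L := by
    have h1 : 1 ≤ 14 * Lam / lam := by rw [le_div_iff₀ hlam]; linarith
    exact one_le_mul_of_one_le_of_one_le h1 hK
  have hLK : 0 < 2 * (L * K) := by positivity
  -- The first bound, with `η₂ ≤ 1`, gives the decay ratio. The second makes `c₁⁻¹` exceed `K` and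
  -- leaves room for the smallness factor `L`.
  set c₁ : ℝ := min (gain n lam Lam) (1 / (2 * (L * K))) with hc₁
  have hc0 : 0 < c₁ := lt_min hg0 (by positivity)
  have hc1 : c₁ < 1 := (min_le_left _ _).trans_lt hg1
  have hcLK : c₁ * (2 * (L * K)) ≤ 1 := by
    rw [← le_div_iff₀ hLK]; exact min_le_right _ _
  have hcK : K * c₁ ≤ 1 / 2 := by
    have : K * c₁ ≤ L * (K * c₁) := le_mul_of_one_le_left (by positivity) hL
    nlinarith
  refine ⟨c₁, hc0, hc1, ?_⟩
  intro δ hδ F hF u hu hbdd _ hsuper θ T₀ x₀ t₀ hθ hθ4 hT₀ hQ a ha _ h0 k hk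
  obtain ⟨b, hb⟩ := hbdd
  set m := sInf (u '' Q₁ n) with hm
  set v : Space n × ℝ → ℝ := fun z => u z - m with hv
  have hc : ContinuousOn v (Metric.closedBall 0 1 ×ˢ univ) := hu.sub continuousOn_const
  have hv0 : ∀ z ∈ Q₁ n, 0 ≤ v z := by
    intro z hz
    refine sub_nonneg.2 (csInf_le ⟨-b, ?_⟩ (mem_image_of_mem u hz))
    rintro _ ⟨w, hw, rfl⟩
    exact (abs_le.1 (hb w ⟨Metric.ball_subset_closedBall hw.1, mem_univ _⟩)).1
  have h0P : (x₀, t₀) ∈ Q₁ n := hQ ⟨by simp, by simpa using hT₀.le⟩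
  have h0' : (x₀, t₀) ∈ closedContactSet a v := by
    obtain ⟨-, y, s, hys, hlt, heq⟩ := h0
    exact ⟨h0P, (y, s), hys, le_on_closed_cylinder hc
      (contDiff_concaveParabola a y s).continuous (fun ξ hξ τ hτ => (hlt ξ hξ τ hτ).le), heq⟩
  have hkδ : a ≤ c₁ ^ k * δ := by
    have h1 : (c₁⁻¹) ^ k * a ≤ δ :=
      hk.trans (mul_le_of_le_one_left hδ.le (c₀_le_one hlam hlam1 hLam))
    rw [inv_pow, inv_mul_le_iff₀ (by positivity)] at h1
    exact h1
  have hsmall : ∀ j < k, L * (K ^ j * a) < δ := by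
    intro j hj
    -- Only openings before the last step must be small, so of the `k` factors in `a ≤ c₁ ^ k * δ`
    -- one is left over to absorb `L`.
    obtain ⟨i, rfl⟩ : ∃ i, k = i + 1 := ⟨k - 1, by omega⟩
    have h1 : K ^ j ≤ K ^ i := pow_le_pow_right₀ hK (by omega)
    have h2 : (K * c₁) ^ i ≤ 1 := pow_le_one₀ (by positivity) (by linarith)
    have h3 : L * c₁ ≤ 1 / 2 := by
      have : L * c₁ ≤ K * (L * c₁) := le_mul_of_one_le_left (by positivity) hK
      nlinarith
    calc L * (K ^ j * a) ≤ L * (K ^ i * (c₁ ^ (i + 1) * δ)) := by gcongr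
      _ = (L * c₁) * (K * c₁) ^ i * δ := by rw [mul_pow]; ring
      _ ≤ (1 / 2) * 1 * δ := by gcongr
      _ < δ := by linarith
  have hsub : lowerPB θ T₀ x₀ t₀ \ contactSet ((c₁⁻¹) ^ k * a) (closedQ₁ n) u ⊆
      lowerPB θ T₀ x₀ t₀ \ closedContactSet (K ^ k * a) v ∨ k = 0 := by
    -- For `k = 0` the opening does not grow, so strict contact cannot be gained; there the claim is
    -- monotonicity of measure.
    rcases Nat.eq_zero_or_pos k with h | h
    · exact Or.inr h
    left
    have hlt : K ^ k * a < (c₁⁻¹) ^ k * a := by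
      refine mul_lt_mul_of_pos_right (pow_lt_pow_left₀ ?_ (by linarith) h.ne') ha
      rw [lt_inv_comm₀ (by linarith) hc0, lt_inv_comm₀ hc0 (by linarith)]
      rw [← one_div, lt_div_iff₀ hc0]
      linarith
    refine sdiff_subset_sdiff_right fun z hz => ?_
    obtain ⟨e, he, -, hcontact⟩ := exists_steeper_contact hv0 (by positivity) hlt hz
    exact ⟨Metric.ball_subset_closedBall hz.1.1, e.1, e.2, he, hcontact⟩
  rcases hsub with hsub | rfl
  · refine (measure_mono hsub).trans ((volume_diff_iterate hn hlam hlam1 hLam hF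
      (hsuper.sub_const m) hc hv0 ha hθ hθ4 hT₀ hQ h0' k hsmall).trans ?_)
    refine mul_le_mul_left (ENNReal.ofReal_le_ofReal (pow_le_pow_left₀ (by linarith) ?_ k)) _
    have h1 : η₂ n * c₁ ≤ c₁ := mul_le_of_le_one_left hc0.le hη1
    have h2 : c₁ ≤ gain n lam Lam := min_le_left _ _
    linarith
  · simpa using measure_mono sdiff_subset
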